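/- Fix a universe of small sets. Let $\mathbf a$ be an essentially small additive category. **Notation.** The category $\mathsf{Noy}\,\mathbf a$ has the morphisms of $\mathbf a$ as objects; a morphism from $f:X^0\to X^1$ to $g:Y^0\to Y^1$ is an equivalence class of morphisms $\alpha:X^0\to Y^0$ for which $g\circ\alpha$ factors through $f$, where $\alpha\sim\alpha'$ if $\alpha-\alpha'$ factors through $f$. Let $\mathtt N:\mathbf a\to\mathsf{Noy}\,\mathbf a$ be the functor $A\mapsto(A\to 0)$. For an additive category $\mathbf b$, an additive sieve on $X\in\mathbf b$ is a subfunctor $R$ of the additive presheaf $\mathbf b(-,X):\mathbf b^{\mathrm{op}}\to\mathsf{Ab}$. An additive Grothendieck topology $\mathcal T$ on $\mathbf b$ is a family of sets $\mathcal T(X)$ of additive sieves on $X$ such that $\mathbf b(-,X)\in\mathcal T(X)$; such that $f^{-1}R\in\mathcal T(Y)$ for all $f:Y\to X$ and $R\in\mathcal T(X)$; and such that an additive sieve $S$ on $X$ lies in $\mathcal T(X)$ if there is $R\in\mathcal T(X)$ with $f^{-1}S\in\mathcal T(Y)$ for all $Y$ and all $f\in R(Y)$. $\mathsf{Sh}(\mathbf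 b,\mathcal T)$ is the category of additive presheaves of abelian groups $F$ such that $F(X)\to\mathrm{Hom}(R,F)$ is bijective for all $X$ and $R\in\mathcal T(X)$, and $\mathtt Z:\mathbf b\to\mathsf{Sh}(\mathbf b,\mathcal T)$ is the Yoneda embedding followed by the sheafification. The set $\mathcal H\mathcal Top(\mathbf a)$ of homological topologies on $\mathbf a$ is the set of additive Grothendieck topologies on $\mathsf{Noy}\,\mathbf a$. For $\mathcal R\in\mathcal H\mathcal Top(\mathbf a)$ put $$\mathsf{HSh}(\mathbf a,\mathcal R)=\mathsf{Sh}(\mathsf{Noy}\,\mathbf a,\mathcal R),\qquad \mathtt{HZ}=\mathtt Z\circ\mathtt N:\mathbf a\to\mathsf{HSh}(\mathbf a,\mathcal R).$$ Let $\mathcal{AB}_5$ be the 2-category of AB5 categories (locally small cocomplete abelian categories with exact filtered colimits), faithful exact cocontinuous functors and all natural transformations. For $\mathbf C\in\mathcal{AB}_5$ let $[\mathbf a,\mathbf C]$ be the category of additive functors $\mathbf a\to\mathbf C$. For $\theta\in[\mathbf a,\mathbf C]$ let $\vec\theta:\mathsf{Noy}\,\mathbf a\to\mathbf C$ be the functor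 $f\mapsto\ker\theta(f)$, and let $\mathcal{HT}_\theta(X)$, for $X\in\mathsf{Noy}\,\mathbf a$, be the set of additive sieves on $X$ that contain a small family of morphisms $f_i:Y_i\to X$ for which $\bigoplus_i\vec\theta(Y_i)\to\vec\theta(X)$ is an epimorphism. Let $[\mathbf a,\mathbf C]_{\mathcal R}$ be the full subcategory of $[\mathbf a,\mathbf C]$ of the functors $\theta$ with $\mathcal{HT}_\theta=\mathcal R$. **Theorem.** 1. The 2-functor $[\mathbf a,-]:\mathcal{AB}_5\to\mathcal Cat$ decomposes over the homological topologies, $$[\mathbf a,-]=\coprod_{\mathcal R\in\mathcal H\mathcal Top(\mathbf a)}[\mathbf a,-]_{\mathcal R},$$ in the following sense. For each $\mathbf C\in\mathcal{AB}_5$ the canonical functor $\coprod_{\mathcal R}[\mathbf a,\mathbf C]_{\mathcal R}\to[\mathbf a,\mathbf C]$ is bijective on objects (that is, $\mathcal{HT}_\theta$ is an additive Grothendieck topology on $\mathsf{Noy}\,\mathbf a$ for each $\theta$), fully faithful on each summand, and an equivalence between the underlying groupoids (the categories with the same objects and only the isomorphisms); and $\mathcal{HT}_{G\circ\theta}=\mathcal{HT}_\theta$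 for each $\theta\in[\mathbf a,\mathbf C]$ and each 1-morphism $G:\mathbf C\to\mathbf B$ of $\mathcal{AB}_5$, so that the $[\mathbf a,-]_{\mathcal R}$ are sub-2-functors of $[\mathbf a,-]$. 2. For each $\mathcal R\in\mathcal H\mathcal Top(\mathbf a)$, the 2-functor $[\mathbf a,-]_{\mathcal R}$ is represented by $\mathsf{HSh}(\mathbf a,\mathcal R)$: this is an AB5 category, and for each $\mathbf C\in\mathcal{AB}_5$ composition with $\mathtt{HZ}$ takes values in $[\mathbf a,\mathbf C]_{\mathcal R}$ and yields an equivalence $$\mathcal{AB}_5(\mathsf{HSh}(\mathbf a,\mathcal R),\mathbf C)\xrightarrow{\ \sim\ }[\mathbf a,\mathbf C]_{\mathcal R},$$ 2-naturally in $\mathbf C$. 3. For each $\mathcal R\in\mathcal H\mathcal Top(\mathbf a)$, the functor $\mathtt{HZ}:\mathbf a\to\mathsf{HSh}(\mathbf a,\mathcal R)$ is AB3-tight: every full subcategory of $\mathsf{HSh}(\mathbf a,\mathcal R)$ that contains the image of $\mathtt{HZ}$ and is closed under kernels, cokernels and small coproducts is all of $\mathsf{HSh}(\mathbf a,\mathcal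 R)$. -/

import Mathlib

open CategoryTheory CategoryTheory.Limits Opposite

universe w v u v₁ u₁ v₂ u₂ v₃ u₃

namespace HomTop

noncomputable section

section Noy

variable (a : Type u) [Category.{w} a] [Preadditive a]

/-- The category `Noy a`: objects are the morphisms of `a`, a morphism from `f : X⁰ ⟶ X¹` to
`g : Y⁰ ⟶ Y¹` is the class of some `α : X⁰ ⟶ Y⁰` for which `f`, `α`, `g` can be completed to a
commutative square, where `α` and `α'` are equivalent if `α - α'` factors through `f`.
(Two squares with the same `α` are identified: their difference factors through `f` via `0`.) -/
def Noy := CategoryTheory.Quotient (Arrow.leftHomotopic a)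

instance : Category.{w} (Noy a) :=
  inferInstanceAs <| Category.{w} (CategoryTheory.Quotient (Arrow.leftHomotopic a))

instance : Preadditive (Noy a) :=
  Quotient.preadditive _ (by
    rintro _ _ _ _ _ _ ⟨h⟩ ⟨h'⟩
    exact ⟨Arrow.LeftHomotopy.add h h'⟩)

/-- The functor sending a commutative square to its class. -/
def Noy.quotient : Arrow a ⥤ Noy a := CategoryTheory.Quotient.functor _

instance : (Noy.quotient a).Full := Quotient.full_functor _

instance : (Noy.quotient a).EssSurj := Quotient.essSurj_functor _

instance : (Noy.quotient a).Additive where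

instance [HasBinaryBiproducts a] : HasBinaryBiproducts (Noy a) := by
  have : HasBinaryProducts (Arrow a) := inferInstance
  have : HasBinaryBiproducts (Arrow a) := HasBinaryBiproducts.of_hasBinaryProducts
  have : PreservesBinaryBiproducts (Noy.quotient a) :=
    preservesBinaryBiproducts_of_preservesBiproducts _
  exact ⟨fun X Y => Functor.hasBinaryBiproduct_of_preserves (Noy.quotient a) X.as Y.as⟩

instance [EssentiallySmall.{w} a] : EssentiallySmall.{w} (Noy a) := by
  have h : Small.{w} (Arrow (SmallModel.{w} a)) := inferInstance
  rw [essentiallySmall_iff]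
  refine ⟨?_, inferInstance⟩
  refine small_of_surjective (f := fun x : Arrow (SmallModel.{w} a) =>
    toSkeleton ((Noy.quotient a).obj ((equivSmallModel.{w} a).inverse.mapArrow.obj x))) ?_
  intro X
  obtain ⟨X, rfl⟩ := X.exists_rep
  obtain ⟨x, ⟨e⟩⟩ : ∃ x, Nonempty ((equivSmallModel.{w} a).inverse.mapArrow.obj x ≅ X.as) :=
    ⟨_, ⟨(equivSmallModel.{w} a).inverse.mapArrow.objObjPreimageIso X.as⟩⟩
  exact ⟨x, congr_toSkeleton_of_iso ((Noy.quotient a).mapIso e)⟩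

variable [HasZeroObject a]

open ZeroObject in
/-- The functor sending `A` to the arrow `A ⟶ 0`. -/
def toArrow : a ⥤ Arrow a where
  obj A := Arrow.mk (0 : A ⟶ 0)
  map f := Arrow.homMk f 0
  map_id A := by
    ext
    · simp
    · exact (isZero_zero a).eq_of_src _ _
  map_comp f g := by
    ext
    · simp
    · exact (isZero_zero a).eq_of_src _ _

instance : (toArrow a).Additive where
  map_add {A B f g} := by
    ext
    · rfl
    · exact (isZero_zero a).eq_of_src _ _

/-- The functor `N : a ⥤ Noy a` sending `A` to the object `A ⟶ 0`. -/
def Noy.N : a ⥤ Noy a := toArrow a ⋙ Noy.quotient a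

instance : (Noy.N a).Additive := inferInstanceAs (toArrow a ⋙ Noy.quotient a).Additive

variable {a}
variable {C : Type u₁} [Category.{v₁} C] [Preadditive C] [HasKernels C]

/-- The functor on the arrow category of `a` sending `f` to the kernel of `θ f`. -/
def arrowKernel (θ : a ⥤ C) : Arrow a ⥤ C where
  obj f := kernel (θ.map f.hom)
  map {f g} α := kernel.map _ _ (θ.map α.left) (θ.map α.right)
    (by rw [← θ.map_comp, ← θ.map_comp]; exact congrArg θ.map α.w.symm)
  map_id f := by ext; simp
  map_comp α β := by ext; simp

/-- The functor `θ⃗ : Noy a ⥤ C` induced by an additive functor `θ : a ⥤ C`, sending `f` to the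
kernel of `θ f`. -/
def vec (θ : a ⥤ C) [θ.Additive] : Noy a ⥤ C :=
  CategoryTheory.Quotient.lift _ (arrowKernel θ) (by
    rintro f g α β ⟨h⟩
    have h1 := congrArg θ.map h.comm
    rw [θ.map_sub, θ.map_comp, sub_eq_iff_eq_add] at h1
    apply (cancel_mono (kernel.ι _)).1
    simp [arrowKernel, h1, Preadditive.comp_add])

end Noy

section Topology

lemma isSheaf_forget_iff {b : Type u} [Category.{w} b] [EssentiallySmall.{w} b]
    (J : GrothendieckTopology b) (P : bᵒᵖ ⥤ AddCommGrpCat.{w}) :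
    Presheaf.IsSheaf J P ↔
      Presieve.IsSheaf J (P ⋙ CategoryTheory.forget AddCommGrpCat.{w}) := by
  rw [← isSheaf_iff_isSheaf_of_type, Presheaf.isSheaf_iff_isLimit, Presheaf.isSheaf_iff_isLimit]
  refine forall_congr' fun X => forall_congr' fun S => forall_congr' fun hS => ?_
  have : EssentiallySmall.{w} (Over X) :=
    inferInstanceAs (EssentiallySmall.{w} (CostructuredArrow (𝟭 b) X))
  have h : EssentiallySmall.{w} S.arrows.category :=
    essentiallySmall_of_fully_faithful (ObjectProperty.ι _)
  have : HasLimitsOfShape S.arrows.categoryᵒᵖ AddCommGrpCat.{w} :=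
    hasLimitsOfShape_of_essentiallySmall.{w} _ _
  have : PreservesLimitsOfShape S.arrows.categoryᵒᵖ (CategoryTheory.forget AddCommGrpCat.{w}) :=
    preservesLimitsOfShape_of_equiv (equivSmallModel.{w} _).symm _
  have : ReflectsLimitsOfShape S.arrows.categoryᵒᵖ (CategoryTheory.forget AddCommGrpCat.{w}) :=
    reflectsLimitsOfShape_of_reflectsIsomorphisms
  exact ⟨fun ⟨t⟩ => ⟨isLimitOfPreserves (CategoryTheory.forget AddCommGrpCat.{w}) t⟩,
    fun ⟨t⟩ => ⟨isLimitOfReflects (CategoryTheory.forget AddCommGrpCat.{w}) t⟩⟩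

variable {b : Type u} [Category.{w} b] [Preadditive b]

/-- An additive sieve on `X`, i.e. a subfunctor of the additive presheaf `b(-, X)`. -/
@[ext]
structure AdditiveSieve (X : b) where
  /-- the morphisms `Y ⟶ X` that belong to the sieve -/
  arrows (Y : b) : AddSubgroup (Y ⟶ X)
  comp_mem {Y Z : b} (g : Z ⟶ Y) {f : Y ⟶ X} (hf : f ∈ arrows Y) : g ≫ f ∈ arrows Z

/-- The maximal sieve `b(-, X)`. -/
def AdditiveSieve.top (X : b) : AdditiveSieve X where
  arrows _ := ⊤
  comp_mem _ _ _ := trivial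

/-- The inverse image of a sieve on `X` along `f : Y ⟶ X`. -/
def AdditiveSieve.pullback {X Y : b} (f : Y ⟶ X) (R : AdditiveSieve X) : AdditiveSieve Y where
  arrows Z := (R.arrows Z).comap (Preadditive.rightComp Z f)
  comp_mem {Z W} g h hh := by
    change (g ≫ h) ≫ f ∈ R.arrows W
    rw [Category.assoc]
    exact R.comp_mem g hh

variable (b) in
/-- An additive Grothendieck topology on a preadditive category. -/
@[ext]
structure AdditiveTopology where
  /-- the covering sieves -/
  sieves (X : b) : Set (AdditiveSieve X)
  top_mem (X : b) : AdditiveSieve.top X ∈ sieves X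
  pullback_mem {X Y : b} (f : Y ⟶ X) {R : AdditiveSieve X} (hR : R ∈ sieves X) :
    R.pullback f ∈ sieves Y
  transitive {X : b} {R : AdditiveSieve X} (hR : R ∈ sieves X) (S : AdditiveSieve X)
    (h : ∀ ⦃Y : b⦄ ⦃f : Y ⟶ X⦄, f ∈ R.arrows Y → S.pullback f ∈ sieves Y) : S ∈ sieves X

variable (b) in
/-- The category of additive presheaves of abelian groups. -/
abbrev PSh := bᵒᵖ ⥤+ AddCommGrpCat.{w}

/-- The sheaf condition of an additive presheaf `F` for a sieve `R` on `X`: every morphism of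
additive presheaves `φ : R ⟶ F` extends uniquely to `b(-, X) ⟶ F`, i.e. comes from a unique
element of `F X`. -/
def IsSheafFor (F : PSh b) {X : b} (R : AdditiveSieve X) : Prop :=
  ∀ (φ : ∀ Y : b, R.arrows Y →+ F.obj.obj (op Y)),
    (∀ ⦃Y Z : b⦄ (g : Z ⟶ Y) (f : R.arrows Y),
      φ Z ⟨g ≫ f.1, R.comp_mem g f.2⟩ = F.obj.map g.op (φ Y f)) →
    ∃! s : F.obj.obj (op X), ∀ (Y : b) (f : R.arrows Y), F.obj.map f.1.op s = φ Y f

/-- The property of being a sheaf for an additive topology. -/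
def isSheaf (T : AdditiveTopology b) : ObjectProperty (PSh b) :=
  fun F => ∀ ⦃X : b⦄ ⦃R : AdditiveSieve X⦄, R ∈ T.sieves X → IsSheafFor F R

/-- The category of sheaves for an additive topology. -/
abbrev Sh (T : AdditiveTopology b) := (isSheaf T).FullSubcategory

/-! ### Existence of the sheafification -/

/-- The sieve underlying an additive sieve. -/
def AdditiveSieve.toSieve {X : b} (R : AdditiveSieve X) : Sieve X where
  arrows Y f := f ∈ R.arrows Y
  downward_closed hf g := R.comp_mem g hf

/-- The coverage given by the sieves of an additive topology. -/
def AdditiveTopology.coverage (T : AdditiveTopology b) : Coverage b where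
  coverings X := {S | ∃ R ∈ T.sieves X, S = R.toSieve.arrows}
  pullback := by
    rintro X Y f _ ⟨R, hR, rfl⟩
    exact ⟨_, ⟨_, T.pullback_mem f hR, rfl⟩, fun Z g hg => ⟨Z, 𝟙 _, g ≫ f, hg, by simp⟩⟩

/-- The ordinary Grothendieck topology generated by the sieves of an additive topology. -/
def AdditiveTopology.toGrothendieck (T : AdditiveTopology b) : GrothendieckTopology b :=
  T.coverage.toGrothendieck

variable [HasBinaryBiproducts b]

/-- For an additive presheaf on an additive category the sheaf condition for an additive sieve
agrees with the one of the underlying presheaf of sets. -/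
lemma isSheafFor_iff (F : PSh b) {X : b} (R : AdditiveSieve X) :
    IsSheafFor F R ↔
      Presieve.IsSheafFor (F.obj ⋙ CategoryTheory.forget _) R.toSieve.arrows := by
  constructor
  · intro H x hx
    have hx' := (Presieve.compatible_iff_sieveCompatible (S := R.toSieve) x).1 hx
    have hadd : ∀ (Y : b) (f g : R.arrows Y), x (f + g).1 (f + g).2 = (x f.1 f.2 + x g.1 g.2 :
        F.obj.obj (op Y)) := by
      intro Y f g
      have hh : biprod.desc f.1 g.1 ∈ R.arrows (Y ⊞ Y) := by
        rw [biprod.desc_eq]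
        exact add_mem (R.comp_mem _ f.2) (R.comp_mem _ g.2)
      have e₁ := hx' (biprod.desc f.1 g.1) (biprod.inl : Y ⟶ Y ⊞ Y) hh
      have e₂ := hx' (biprod.desc f.1 g.1) (biprod.inr : Y ⟶ Y ⊞ Y) hh
      have e₃ := hx' (biprod.desc f.1 g.1) (biprod.inl + biprod.inr : Y ⟶ Y ⊞ Y) hh
      have hc : ∀ {p q : Y ⟶ X} (h : p = q) (hp : R.toSieve p) (hq : R.toSieve q),
          x p hp = x q hq := by
        rintro p _ rfl _ _
        rfl
      rw [hc (biprod.inl_desc _ _) _ f.2] at e₁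
      rw [hc (biprod.inr_desc _ _) _ g.2] at e₂
      rw [hc (by simp [Preadditive.add_comp]) _ (f + g).2] at e₃
      refine e₃.trans (Eq.trans ?_ (congrArg₂ (fun p q : F.obj.obj (op Y) => p + q) e₁ e₂).symm)
      change F.obj.map (biprod.inl + biprod.inr : Y ⟶ Y ⊞ Y).op _ =
        F.obj.map (biprod.inl : Y ⟶ Y ⊞ Y).op _ + F.obj.map (biprod.inr : Y ⟶ Y ⊞ Y).op _
      rw [op_add, F.obj.map_add]
      rfl
    obtain ⟨s, hs, hs'⟩ := H (fun Y => AddMonoidHom.mk' (fun f => x f.1 f.2) (hadd Y))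
      (fun Y Z g f => hx' f.1 g f.2)
    exact ⟨s, fun Y f hf => hs Y ⟨f, hf⟩, fun t ht => hs' t fun Y f => ht f.1 f.2⟩
  · intro H φ hφ
    obtain ⟨s, hs, hs'⟩ := H (fun Y f hf => φ Y ⟨f, hf⟩)
      ((Presieve.compatible_iff_sieveCompatible (S := R.toSieve) _).2
        fun Y Z f g hf => hφ g ⟨f, hf⟩)
    exact ⟨s, fun Y f => hs f.1 f.2, fun t ht => hs' t fun Y f hf => ht Y ⟨f, hf⟩⟩

/-- The coverings of the generated topology can be refined compatibly with addition. -/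
lemma AdditiveTopology.exists_refinement (T : AdditiveTopology b) {X : b} {S : Sieve X}
    (hS : S ∈ T.toGrothendieck X) {Y : b} (k : Y ⊞ Y ⟶ X) :
    ∃ S' ∈ T.toGrothendieck Y, ∀ ⦃Z : b⦄ (h : Z ⟶ Y), S' h → S (biprod.map h h ≫ k) := by
  induction hS generalizing Y with
  | of X S hS =>
    obtain ⟨R, hR, rfl⟩ := hS
    have hc : ∀ f : Y ⟶ X, (R.pullback f).toSieve ∈ T.toGrothendieck Y := fun f => by
      rw [← Sieve.generate_sieve (R.pullback f).toSieve]
      exact Coverage.Saturate.of _ _ ⟨_, T.pullback_mem f hR, rfl⟩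
    refine ⟨_, T.toGrothendieck.intersection_covering (hc (biprod.inl ≫ k))
      (hc (biprod.inr ≫ k)), fun Z h hh => ?_⟩
    refine Sieve.le_generate _ _ _ ?_
    have : biprod.map h h ≫ k =
        biprod.fst ≫ h ≫ biprod.inl ≫ k + biprod.snd ≫ h ≫ biprod.inr ≫ k := by
      apply biprod.hom_ext' <;> simp
    change _ ∈ R.arrows _
    rw [this]
    exact add_mem (R.comp_mem _ hh.1) (R.comp_mem _ hh.2)
  | top X => exact ⟨⊤, T.toGrothendieck.top_mem _, fun _ _ _ => trivial⟩
  | transitive X R S _ _ ih₁ ih₂ =>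
    obtain ⟨R', hR', h'⟩ := ih₁ k
    choose S' hS' hS'' using fun (Z : b) (h : Z ⟶ Y) (hh : R' h) =>
      ih₂ (h' h hh) (𝟙 (Z ⊞ Z))
    refine ⟨Sieve.bind R'.arrows fun Z h hh => S' Z h hh,
      T.toGrothendieck.bind_covering hR' fun Z h hh => hS' Z h hh, ?_⟩
    rintro Z _ ⟨W, g, h, hh, hg, rfl⟩
    have := hS'' W h hh g hg
    simp only [Category.comp_id, Sieve.pullback_apply] at this
    convert this using 1
    apply biprod.hom_ext' <;> simp

variable [EssentiallySmall.{w} b]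

lemma isSheaf_iff (T : AdditiveTopology b) (F : PSh b) :
    isSheaf T F ↔ Presheaf.IsSheaf T.toGrothendieck F.obj := by
  rw [isSheaf_forget_iff]
  refine Iff.trans ?_ (Presieve.isSheaf_coverage T.coverage _).symm
  constructor
  · rintro H X _ ⟨R, hR, rfl⟩
    exact (isSheafFor_iff F R).1 (H hR)
  · intro H X R hR
    exact (isSheafFor_iff F R).2 (H _ ⟨R, hR, rfl⟩)

instance (J : GrothendieckTopology b) : HasSheafify J AddCommGrpCat.{w} :=
  hasSheafifyEssentiallySmallSite.{w} _ _

instance (J : GrothendieckTopology b) : J.WEqualsLocallyBijective AddCommGrpCat.{w} :=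
  GrothendieckTopology.WEqualsLocallyBijective.ofEssentiallySmall.{w} _

/-- The sheafification of an additive presheaf is additive. -/
lemma additive_sheafify (T : AdditiveTopology b) (F : PSh b) :
    ((presheafToSheaf T.toGrothendieck AddCommGrpCat.{w}).obj F.obj).obj.Additive where
  map_add {X Y f g} := by
    let G := (presheafToSheaf T.toGrothendieck AddCommGrpCat.{w}).obj F.obj
    change G.obj.map (f + g) = G.obj.map f + G.obj.map g
    ext s
    let η : F.obj ⟶ G.obj := toSheafify T.toGrothendieck F.obj
    have hη : Presheaf.IsLocallySurjective T.toGrothendieck η :=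
      inferInstanceAs (Presheaf.IsLocallySurjective _ (toSheafify T.toGrothendieck F.obj))
    have hS := Presheaf.imageSieve_mem T.toGrothendieck η s
    obtain ⟨S', hS', h'⟩ := T.exists_refinement hS (biprod.desc f.unop g.unop)
    have hsep := (((isSheaf_forget_iff _ _).1 G.property) S' hS').isSeparatedFor
    refine hsep.ext fun Z h hh => ?_
    obtain ⟨t, ht⟩ := h' h hh
    have key : ∀ k : Z ⟶ Z ⊞ Z,
        G.obj.map (k ≫ biprod.map h h ≫ biprod.desc f.unop g.unop).op s =
          η.app (op Z) (F.obj.map k.op t) := by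
      intro k
      rw [op_comp, G.obj.map_comp, ConcreteCategory.comp_apply, ← ht,
        NatTrans.naturality_apply]
    have k₁ := key biprod.inl
    have k₂ := key biprod.inr
    have k₃ := key (biprod.inl + biprod.inr)
    rw [op_add, F.obj.map_add, AddCommGrpCat.hom_add_apply, map_add, ← k₁, ← k₂] at k₃
    have e₁ : (biprod.inl : Z ⟶ Z ⊞ Z) ≫ biprod.map h h ≫ biprod.desc f.unop g.unop =
      h ≫ f.unop := by simp
    have e₂ : (biprod.inr : Z ⟶ Z ⊞ Z) ≫ biprod.map h h ≫ biprod.desc f.unop g.unop =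
      h ≫ g.unop := by simp
    rw [Preadditive.add_comp, e₁, e₂, ← Preadditive.comp_add] at k₃
    simp only [op_comp, op_add, Quiver.Hom.op_unop, G.obj.map_comp,
      ConcreteCategory.comp_apply] at k₃
    change G.obj.map h.op (G.obj.map (f + g) s) =
      G.obj.map h.op ((G.obj.map f + G.obj.map g) s)
    rw [AddCommGrpCat.hom_add_apply, map_add]
    exact k₃

/-- The sheafification of an additive presheaf as an object of `Sh T`. -/
def sheafifyObj (T : AdditiveTopology b) (F : PSh b) : Sh T :=
  let G := (presheafToSheaf T.toGrothendieck AddCommGrpCat.{w}).obj F.obj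
  ⟨⟨G.obj, additive_sheafify T F⟩, (isSheaf_iff T _).2 G.property⟩

/-- The inclusion of sheaves into additive presheaves has a left adjoint. -/
instance (T : AdditiveTopology b) : (isSheaf T).ι.IsRightAdjoint := by
  let J := T.toGrothendieck
  let e : ∀ (F : PSh b) (G : Sh T), (sheafifyObj T F ⟶ G) ≃ (F ⟶ (isSheaf T).ι.obj G) :=
    fun F G =>
      { toFun := fun α => ObjectProperty.homMk (toSheafify J F.obj ≫ α.hom.hom)
        invFun := fun β => ObjectProperty.homMk (ObjectProperty.homMk
          (sheafifyLift J β.hom ((isSheaf_iff T _).1 G.property)))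
        left_inv := fun α => by
          ext1
          ext1
          exact (sheafifyLift_unique J _ _ _ rfl).symm
        right_inv := fun β => by
          ext1
          exact toSheafify_sheafifyLift J _ _ }
  exact (Adjunction.adjunctionOfEquivLeft e (fun F G G' α β => by
    ext1
    simp only [e, Equiv.coe_fn_mk, ObjectProperty.homMk_hom, ObjectProperty.FullSubcategory.comp_hom,
      ObjectProperty.ι_map]
    exact (Category.assoc _ _ _).symm)).isRightAdjoint

/-- The additive Yoneda embedding `Y : b ⥤ PSh b`. -/
def yon : b ⥤ PSh b := (additiveFunctor _ _).lift preadditiveYoneda fun X =>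
  (inferInstance : (preadditiveYoneda.obj X).Additive)

instance : (yon : b ⥤ PSh b).Additive where
  map_add {X Y f g} := by
    ext1
    ext Z h
    exact Preadditive.comp_add _ _ _ _ _ _

/-- The functor `Z : b ⥤ Sh T`, the composite of the Yoneda embedding and the sheafification. -/
def zed (T : AdditiveTopology b) : b ⥤ Sh T := yon ⋙ (isSheaf T).ι.leftAdjoint

instance (T : AdditiveTopology b) : (isSheaf T).ι.leftAdjoint.Additive :=
  (Adjunction.ofIsRightAdjoint (isSheaf T).ι).left_adjoint_additive

instance (T : AdditiveTopology b) : (zed T).Additive :=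
  inferInstanceAs (yon ⋙ (isSheaf T).ι.leftAdjoint).Additive

end Topology

section AB5

/-- AB5 categories relative to the universe `w` of small sets, for a preadditive category:
abelian (for the given preadditive structure), locally small, with small colimits, and with exact
filtered colimits. -/
structure IsAB5Category (C : Type u₁) [Category.{v₁} C] [Preadditive C] : Prop where
  exists_abelian : ∃ h : Abelian C, h.toPreadditive = ‹Preadditive C›
  locallySmall : LocallySmall.{w} C
  hasColimits : HasColimitsOfSize.{w, w} C
  ab5 : AB5OfSize.{w, w} C

/-- AB3 subcategories of an AB3 category: full subcategories closed under kernels, cokernels and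
small coproducts (in particular they contain the zero objects and finite direct sums). -/
structure IsAB3Subcategory {A : Type u₁} [Category.{v₁} A] [Preadditive A]
    (P : ObjectProperty A) : Prop where
  kernels : P.IsClosedUnderKernels
  cokernels : P.IsClosedUnderCokernels
  coproducts (J : Type w) : P.IsClosedUnderColimitsOfShape (Discrete J)

/-- A functor `φ` to an AB3 category `A` is AB3-tight if `A` is its only AB3 subcategory that
contains the image of `φ`. -/
def AB3Tight {a : Type u} [Category.{v} a] {A : Type u₁} [Category.{v₁} A] [Preadditive A]
    (φ : a ⥤ A) : Prop :=
  ∀ P : ObjectProperty A, IsAB3Subcategory.{w} P → (∀ X : a, P (φ.obj X)) → P = ⊤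

variable (D : Type u₁) [Category.{v₁} D] [Preadditive D]
  (C : Type u₂) [Category.{v₂} C] [Preadditive C] (B : Type u₃) [Category.{v₃} B] [Preadditive B]

/-- The faithful exact cocontinuous functors, i.e. the 1-morphisms of the 2-category of AB5
categories. (Additivity is implied by exactness if `D` and `C` are abelian.) -/
def isAB5Functor : ObjectProperty (D ⥤ C) := fun F =>
  F.Additive ∧ F.Faithful ∧ PreservesFiniteLimits F ∧ PreservesFiniteColimits F ∧
    PreservesColimitsOfSize.{w, w} F

/-- The category of faithful exact cocontinuous functors and all natural transformations. -/
abbrev AB5Hom := (isAB5Functor.{w} D C).FullSubcategory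

/-- Composition in the 2-category of AB5 categories. -/
def AB5Hom.comp : AB5Hom.{w} D C ⥤ AB5Hom.{w} C B ⥤ AB5Hom.{w} D B where
  obj F := (isAB5Functor.{w} D B).lift
    ((isAB5Functor.{w} C B).ι ⋙ (Functor.whiskeringLeft D C B).obj F.obj) (fun G => by
      obtain ⟨_, _, _, _, _⟩ := F.property
      obtain ⟨_, _, _, _, _⟩ := G.property
      exact ⟨inferInstanceAs (F.obj ⋙ G.obj).Additive, inferInstanceAs (F.obj ⋙ G.obj).Faithful,
        comp_preservesFiniteLimits F.obj G.obj, comp_preservesFiniteColimits F.obj G.obj,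
        inferInstanceAs (PreservesColimitsOfSize.{w, w} (F.obj ⋙ G.obj))⟩)
  map α := { app G := ObjectProperty.homMk (Functor.whiskerRight α.hom G.obj) }

variable {D} {a : Type u} [Category.{v} a] [Preadditive a]

/-- The functor sending `F : D ⥤ C` to the composite of the additive functor `θ : a ⥤ D`
and `F`. -/
def precomp (θ : a ⥤+ D) : AB5Hom.{w} D C ⥤ (a ⥤+ C) :=
  (additiveFunctor a C).lift
    ((isAB5Functor.{w} D C).ι ⋙ (Functor.whiskeringLeft a D C).obj θ.obj) (fun F => by
      have := F.property.1
      exact inferInstanceAs (θ.obj ⋙ F.obj).Additive)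

variable (a) in
/-- The action of 1-morphisms and 2-morphisms between AB5 categories on the categories
`a ⥤+ C` of additive functors. -/
def postcomp : (a ⥤+ C) ⥤ AB5Hom.{w} C B ⥤ (a ⥤+ B) where
  obj θ := precomp B θ
  map α :=
    { app G := ObjectProperty.homMk (Functor.whiskerRight α.hom G.obj)
      naturality G G' f := by
        ext1
        ext X
        exact (f.hom.naturality (α.hom.app X)).symm }
  map_id θ := by
    ext G
    exact G.obj.map_id _
  map_comp α β := by
    ext G
    exact G.obj.map_comp _ _

end AB5

section HomologicalTopology

variable {a : Type u} [Category.{w} a] [Preadditive a]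
variable {C : Type u₁} [Category.{v₁} C] [Preadditive C] [HasCoproducts.{w} C]

/-- The covering system `T_φ` of a functor `φ : b ⥤ C`: a sieve `R` on `X` belongs to it if it
contains a (small) collection of morphisms `f i : Y i ⟶ X` such that `⊕ φ (Y i) ⟶ φ X` is an
epimorphism. -/
def coveringSystem {b : Type u₂} [Category.{v₂} b] [Preadditive b] (φ : b ⥤ C) (X : b) :
    Set (AdditiveSieve X) :=
  {R | ∃ (I : Type w) (Y : I → b) (f : ∀ i, Y i ⟶ X),
    (∀ i, f i ∈ R.arrows (Y i)) ∧ Epi (Sigma.desc fun i => φ.map (f i))}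

variable (a) in
/-- Homological topologies on `a` are additive Grothendieck topologies on `Noy a`. -/
abbrev HTop := AdditiveTopology (Noy a)

/-- The covering system on `Noy a` of an additive functor `θ : a ⥤ C`, i.e. the homological
topology of `θ`. -/
def homologicalTopology [HasKernels C] (θ : a ⥤+ C) (X : Noy a) : Set (AdditiveSieve X) :=
  coveringSystem (vec θ.obj) X

variable (C) in
/-- The property of an additive functor `a ⥤ C` to have `R` as its homological topology. -/
def hasHTop [HasKernels C] (R : HTop a) : ObjectProperty (a ⥤+ C) :=
  fun θ => homologicalTopology θ = R.sieves

variable (a C) in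
/-- The functor from the coproduct of the categories of additive functors with homological
topology `R`, for all `R`, to the category of all additive functors. -/
def decomposition [HasKernels C] :
    (Σ R : HTop a, (hasHTop C R).FullSubcategory) ⥤ (a ⥤+ C) :=
  CategoryTheory.Sigma.desc fun R => (hasHTop C R).ι

variable [HasZeroObject a] [HasBinaryBiproducts a] [EssentiallySmall.{w} a]

/-- The category `HSh(a, R) = Sh(Noy a, R)`. -/
abbrev HSh (R : HTop a) := Sh R

/-- The functor `HZ = Z ∘ N : a ⥤ HSh(a, R)`. -/
def HZ (R : HTop a) : a ⥤+ HSh R :=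
  ⟨Noy.N a ⋙ zed R, inferInstanceAs (Noy.N a ⋙ zed R).Additive⟩

end HomologicalTopology

end

end HomTop

open CategoryTheory CategoryTheory.Limits HomTop

/-! Every object of `Noy a` is the kernel of a morphism in the image of `N`, so an additive functor
`θ` has, up to isomorphism, exactly one left exact extension along `N`, namely `vec θ`
(`IsLeftExact.nonempty_iso`). Such extensions have kernel lifts: each morphism of `Noy a` has a weak
kernel whose lifting property holds in the target (`IsLeftExact.hasKernelLifts`).

In an AB5 category an element of a coproduct is locally a finite sum (`eq_zero_of_finite_sums`).
Together with kernel lifts this permits arguing with generalized elements as with local sections.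
Thus jointly epimorphic sieves form a topology (`coveringTopology`), and the presheaves `C(φ -, B)`
are sheaves for it (`JointlyEpi.existsUnique_desc`). The resulting functor from `C` to sheaves has a
left adjoint, the cocontinuous extension `realization` of `φ`.

For a cocontinuous functor `F` on sheaves with kernel lifts along `Z`, an element killed by `F s`
comes locally from morphisms that annihilate `s` (`eq_zero_of_annihilator`). Hence `F` preserves
monomorphisms and is exact; it is faithful if all sieves covering for `Z ⋙ F` belong to the
topology.

Conversely, the covering system of `Z` is the given topology (`coveringSystem_zed`), and faithful
exact cocontinuous functors do not change covering systems (`coveringSystem_comp`). Full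
faithfulness of composition with `HZ` combines the density of `Z` with the uniqueness of left exact
extensions along `N`. Tightness holds because a sheaf is a cokernel of a map between coproducts of
objects `Z X`, which are kernels of morphisms in the image of `HZ`. -/

namespace HomTop

noncomputable section

/-! ### Generalized elements of coproducts in AB5 categories. -/

section LocalVanishing

variable {C : Type u₁} [Category.{v₁} C] [Abelian C]
  [HasColimitsOfSize.{w, w} C] [AB5OfSize.{w, w} C]

open CoproductsFromFiniteFiltered in
attribute [local instance] IsFiltered.isConnected in
/-- In an AB5 category, a morphism vanishes if it vanishes on every generalized element whose
image in a given coproduct is a finite sum. -/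
lemma eq_zero_of_finite_sums {I : Type w} {X : I → C} {A B : C} (g : A ⟶ ∐ X) (z : A ⟶ B)
    (h : ∀ ⦃P : C⦄ (p : P ⟶ A) (J : Finset I) (q : ∀ i, P ⟶ X i),
      p ≫ g = ∑ i ∈ J, q i ≫ Sigma.ι X i → p ≫ z = 0) : z = 0 := by
  classical
  -- By AB5, `A` is the filtered colimit of the pullbacks along `g` of the finite subcoproducts, so
  -- `z` is tested on these.
  refine ((isColimitFiniteSubproductsCocone X).pullbackOfHasExactColimitsOfShape g).hom_ext
    fun F => ?_
  rw [comp_zero, ← cancel_epi (pullbackObjIso _ _ _).inv, comp_zero]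
  have key : ∀ ⦃P : C⦄ (p : P ⟶ A) (t : P ⟶ ∐ fun x : F => X x.1.as),
      p ≫ g = t ≫ ∑ x ∈ F.attach, Sigma.π (fun x : F => X x.1.as) x ≫ Sigma.ι X x.1.as →
        p ≫ z = 0 := by
    intro P p t hp
    -- The value 0 outside `F` is a mere default: the sum runs over `F` only.
    refine h p (F.image Discrete.as) (fun i => if hi : Discrete.mk i ∈ F then
      t ≫ Sigma.π (fun x : F => X x.1.as) ⟨_, hi⟩ else 0) ?_
    rw [hp, Preadditive.comp_sum, Finset.sum_image (by rintro ⟨i⟩ _ ⟨j⟩ _ rfl; rfl),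
      ← Finset.sum_attach F]
    refine Finset.sum_congr rfl fun i _ => ?_
    rw [dif_pos i.2, Category.assoc]
  have key' : pullback.snd ((finiteSubcoproductsCocone X).ι.app F) g ≫ z = 0 :=
    key _ (pullback.fst ((finiteSubcoproductsCocone X).ι.app F) g)
      (pullback.condition.symm.trans
        (congrArg (pullback.fst ((finiteSubcoproductsCocone X).ι.app F) g ≫ ·)
          (finiteSubcoproductsCocone_ι_app_eq_sum X F)))
  simpa using! key'

end LocalVanishing

/-! ### Covering systems as topologies, and gluing along their sieves. -/

section Covering

variable {b : Type u} [Category.{w} b] [Preadditive b]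
variable {C : Type u₁} [Category.{v₁} C]

/-- The images under `φ` of the morphisms of the sieve `R` are jointly epimorphic. -/
def JointlyEpi [HasZeroMorphisms C] (φ : b ⥤ C) {X : b} (R : AdditiveSieve X) : Prop :=
  ∀ ⦃B : C⦄ (z : φ.obj X ⟶ B),
    (∀ ⦃Y : b⦄ (f : Y ⟶ X), f ∈ R.arrows Y → φ.map f ≫ z = 0) → z = 0

/-- Removes the choice of a small family: all members of `R` whose domain lies in a small model of
`b` will do. -/
lemma mem_coveringSystem_iff [EssentiallySmall.{w} b] [Preadditive C] [HasCoproducts.{w} C]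
    (φ : b ⥤ C) {X : b} (R : AdditiveSieve X) :
    R ∈ coveringSystem φ X ↔ JointlyEpi φ R := by
  constructor
  · rintro ⟨I, Y, f, hf, _⟩ B z hz
    rw [← cancel_epi (Sigma.desc fun i => φ.map (f i)), comp_zero]
    ext i
    simpa using hz _ (hf i)
  · intro h
    refine ⟨Σ Y : SmallModel.{w} b, R.arrows ((equivSmallModel.{w} b).inverse.obj Y), _,
      fun i => i.2.1, fun i => i.2.2, Preadditive.epi_of_cancel_zero _ fun z hz => ?_⟩
    refine h z fun Y f hf => ?_
    let e := (equivSmallModel.{w} b).unitIso.app Y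
    rw [← cancel_epi (φ.map e.inv), comp_zero, ← Category.assoc, ← φ.map_comp]
    have := Sigma.ι _ ⟨(equivSmallModel.{w} b).functor.obj Y, ⟨e.inv ≫ f, R.comp_mem _ hf⟩⟩ ≫= hz
    simpa using this

lemma coveringSystem_congr [EssentiallySmall.{w} b] [Preadditive C] [HasCoproducts.{w} C]
    {φ ψ : b ⥤ C} (e : φ ≅ ψ) :
    coveringSystem φ = coveringSystem ψ := by
  ext X R
  simp only [mem_coveringSystem_iff]
  constructor
  · intro h B z hz
    rw [← cancel_epi (e.hom.app X), comp_zero]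
    exact h _ fun Y f hf => by simp [hz f hf]
  · intro h B z hz
    rw [← cancel_epi (e.inv.app X), comp_zero]
    exact h _ fun Y f hf => by simp [hz f hf]

/-- Along a member of `R` the larger sieve `S` pulls back to the maximal sieve, so transitivity
applies. -/
lemma AdditiveTopology.mem_of_le (T : AdditiveTopology b) {X : b} {R S : AdditiveSieve X}
    (hR : R ∈ T.sieves X) (h : ∀ ⦃Y : b⦄ (f : Y ⟶ X), f ∈ R.arrows Y → f ∈ S.arrows Y) :
    S ∈ T.sieves X := by
  refine T.transitive hR S fun Y f hf => ?_
  have : S.pullback f = AdditiveSieve.top Y := by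
    ext Z g
    exact ⟨fun _ => trivial, fun _ => S.comp_mem g (h f hf)⟩
  rw [this]
  exact T.top_mem Y

/-- Every morphism `f` of `b` has a weak kernel `k` such that all generalized elements of the
kernel of `φ f` lift through `φ k`. -/
def HasKernelLifts [HasZeroMorphisms C] (φ : b ⥤ C) : Prop :=
  ∀ ⦃X Y : b⦄ (f : Y ⟶ X), ∃ (W : b) (k : W ⟶ Y), k ≫ f = 0 ∧
    ∀ ⦃A : C⦄ (x : A ⟶ φ.obj Y), x ≫ φ.map f = 0 → ∃ r : A ⟶ φ.obj W, r ≫ φ.map k = x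

/-- Finitely many members of an additive sieve factor through a single one. -/
lemma AdditiveSieve.exists_factor [HasFiniteBiproducts b] {X : b} (R : AdditiveSieve X)
    {I : Type*} (J : Finset I) (Y : I → b) (f : ∀ i, Y i ⟶ X)
    (hf : ∀ i ∈ J, f i ∈ R.arrows (Y i)) :
    ∃ (W : b) (k : ∀ i, Y i ⟶ W) (g : W ⟶ X), g ∈ R.arrows W ∧ ∀ i ∈ J, k i ≫ g = f i := by
  classical
  -- `W` is the direct sum over `J`; outside `J` the value of `k i` does not matter.
  refine ⟨⨁ fun i : J => Y i,
    fun i => if h : i ∈ J then biproduct.ι (fun i : J => Y i) ⟨i, h⟩ else 0,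
    biproduct.desc fun i => f i, ?_, fun i hi => by simp [hi]⟩
  have : biproduct.desc (fun i : J => f i) = ∑ i : J, biproduct.π (fun i : J => Y i) i ≫ f i :=
    biproduct.hom_ext' _ _ fun i => by simp [Preadditive.comp_sum, biproduct.ι_π_assoc,
      Finset.sum_dite_eq, dite_comp]
  rw [this]
  exact sum_mem fun i _ => R.comp_mem _ (hf i i.2)

/-- Weak pullbacks along functors with kernel lifts. -/
lemma HasKernelLifts.exists_pullback [HasBinaryBiproducts b] [Preadditive C] {φ : b ⥤ C}
    [φ.Additive] (hφ : HasKernelLifts φ) {X Y Z : b} (f : Y ⟶ X) (g : Z ⟶ X) :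
    ∃ (W : b) (k : W ⟶ Y) (l : W ⟶ Z), k ≫ f = l ≫ g ∧
      ∀ ⦃A : C⦄ (x : A ⟶ φ.obj Y) (y : A ⟶ φ.obj Z), x ≫ φ.map f = y ≫ φ.map g →
        ∃ r : A ⟶ φ.obj W, r ≫ φ.map k = x ∧ r ≫ φ.map l = y := by
  -- A weak pullback is a weak kernel of `(f, -g)` on the biproduct.
  obtain ⟨W, k, hk, h⟩ := hφ (biprod.desc f (-g))
  refine ⟨W, k ≫ biprod.fst, k ≫ biprod.snd, ?_, fun A x y hxy => ?_⟩
  · rw [biprod.desc_eq] at hk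
    simpa [Preadditive.comp_add, add_neg_eq_zero] using hk
  · obtain ⟨r, hr⟩ := h (x ≫ φ.map biprod.inl + y ≫ φ.map biprod.inr) (by
      simp [Preadditive.add_comp, ← φ.map_comp, hxy])
    refine ⟨r, ?_, ?_⟩
    · rw [φ.map_comp, reassoc_of% hr]
      simp [Preadditive.add_comp, ← φ.map_comp]
    · rw [φ.map_comp, reassoc_of% hr]
      simp [Preadditive.add_comp, ← φ.map_comp]

variable [HasFiniteBiproducts b] [EssentiallySmall.{w} b] [Abelian C]
  [HasColimitsOfSize.{w, w} C] [AB5OfSize.{w, w} C]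

/-- Generalized elements of `φ X` factor locally through the morphisms of a jointly epimorphic
sieve. -/
lemma JointlyEpi.eq_zero_of_factors {φ : b ⥤ C} [φ.Additive] {X : b} {R : AdditiveSieve X}
    (hR : JointlyEpi φ R) {A B : C} (x : A ⟶ φ.obj X) (z : A ⟶ B)
    (h : ∀ ⦃P : C⦄ (p : P ⟶ A) ⦃Y : b⦄ (f : Y ⟶ X) (_ : f ∈ R.arrows Y) (r : P ⟶ φ.obj Y),
      p ≫ x = r ≫ φ.map f → p ≫ z = 0) : z = 0 := by
  obtain ⟨I, Y, f, hf, _⟩ := (mem_coveringSystem_iff φ R).2 hR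
  -- Locally `x` lifts to the coproduct and is a finite sum there; `exists_factor` then sends the
  -- whole sum through one member of `R`.
  obtain ⟨A', π, _, g, hg⟩ := surjective_up_to_refinements_of_epi
    (Sigma.desc fun i => φ.map (f i)) x
  rw [← cancel_epi π, comp_zero]
  refine eq_zero_of_finite_sums g _ fun P p J q hp => ?_
  obtain ⟨W, k, l, hl, hk⟩ := R.exists_factor J Y f fun i _ => hf i
  rw [← Category.assoc]
  refine h (p ≫ π) l hl (∑ i ∈ J, q i ≫ φ.map (k i)) ?_
  rw [Category.assoc, hg, reassoc_of% hp, Preadditive.sum_comp, Preadditive.sum_comp]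
  refine Finset.sum_congr rfl fun i hi => ?_
  simp [← hk i hi]

/-- Compatible families on a jointly epimorphic sieve can be glued uniquely. -/
lemma JointlyEpi.existsUnique_desc {φ : b ⥤ C} [φ.Additive] (hφ : HasKernelLifts φ) {X : b}
    {R : AdditiveSieve X} (hR : JointlyEpi φ R) {B : C}
    (m : ∀ Y : b, R.arrows Y → (φ.obj Y ⟶ B))
    (hm : ∀ ⦃Y Z : b⦄ (g : Z ⟶ Y) (f : R.arrows Y),
      m Z ⟨g ≫ f.1, R.comp_mem g f.2⟩ = φ.map g ≫ m Y f) :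
    ∃! s : φ.obj X ⟶ B, ∀ (Y : b) (f : R.arrows Y), φ.map f.1 ≫ s = m Y f := by
  have := hasBinaryBiproducts_of_finite_biproducts b
  have hm' : ∀ ⦃Y W : b⦄ (k : W ⟶ Y) (f : R.arrows Y) (g : R.arrows W), k ≫ f.1 = g.1 →
      φ.map k ≫ m Y f = m W g := by
    rintro Y W k f ⟨_, _⟩ rfl
    exact (hm k f).symm
  -- The family respects every relation: `r` lifts through a weak kernel `k` of `f`, and
  -- compatibility along `k` gives `φ k ≫ m f = m 0 = 0`.
  have hzero : ∀ ⦃Y : b⦄ (f : R.arrows Y) ⦃A : C⦄ (r : A ⟶ φ.obj Y), r ≫ φ.map f.1 = 0 →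
      r ≫ m Y f = 0 := by
    intro Y f A r hr
    obtain ⟨W, k, hk, h⟩ := hφ f.1
    obtain ⟨r', rfl⟩ := h r hr
    have h₀ : m W 0 = 0 := by
      have := hm' (0 : W ⟶ W) 0 0 (by simp)
      rwa [φ.map_zero, zero_comp, eq_comm] at this
    rw [Category.assoc, hm' k f 0 hk, h₀, comp_zero]
  obtain ⟨I, Y, f, hf, _⟩ := (mem_coveringSystem_iff φ R).2 hR
  let π := Sigma.desc fun i => φ.map (f i)
  let σ := Sigma.desc fun i => m (Y i) ⟨f i, hf i⟩
  -- The glued morphism is `σ` descended along the epimorphism `π`; an element of the kernel is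
  -- locally a finite sum, hence subject to `hzero`.
  have hσ : kernel.ι π ≫ σ = 0 := by
    refine eq_zero_of_finite_sums (kernel.ι π) _ fun P p J q hp => ?_
    obtain ⟨W, k, l, hl, hk⟩ := R.exists_factor J Y f fun i _ => hf i
    have h₁ := hzero ⟨l, hl⟩ (∑ i ∈ J, q i ≫ φ.map (k i)) (by
      have := hp =≫ π
      rw [Category.assoc, kernel.condition, comp_zero, Preadditive.sum_comp] at this
      rw [Preadditive.sum_comp, this]
      refine Finset.sum_congr rfl fun i hi => ?_
      simp [π, ← hk i hi])
    rw [reassoc_of% hp, Preadditive.sum_comp, ← h₁, Preadditive.sum_comp]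
    refine Finset.sum_congr rfl fun i hi => ?_
    simp [σ, hm' (k i) ⟨l, hl⟩ ⟨f i, hf i⟩ (hk i hi)]
  have hs : ∀ i, φ.map (f i) ≫ Abelian.epiDesc π σ hσ = m (Y i) ⟨f i, hf i⟩ := fun i => by
    have := Sigma.ι _ i ≫= Abelian.comp_epiDesc π σ hσ
    simpa only [π, σ, Sigma.ι_desc, Sigma.ι_desc_assoc] using this
  refine ⟨Abelian.epiDesc π σ hσ, fun Z g => ?_, fun t ht => ?_⟩
  -- A member `g` outside the chosen family is compared with a single `l`, through which finitely
  -- many `f i` factor, by a weak pullback of `g` and `l`.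
  · rw [← sub_eq_zero]
    obtain ⟨A', p, _, y, hy⟩ := surjective_up_to_refinements_of_epi π (φ.map g.1)
    rw [← cancel_epi p, comp_zero]
    refine eq_zero_of_finite_sums y _ fun P a J q ha => ?_
    obtain ⟨W, k, l, hl, hk⟩ := R.exists_factor J Y f fun i _ => hf i
    have e₁ : a ≫ p ≫ φ.map g.1 = (∑ i ∈ J, q i ≫ φ.map (k i)) ≫ φ.map l := by
      rw [hy, reassoc_of% ha, Preadditive.sum_comp, Preadditive.sum_comp]
      refine Finset.sum_congr rfl fun i hi => ?_
      simp [π, ← hk i hi]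
    obtain ⟨V, c, d, hcd, hV⟩ := hφ.exists_pullback g.1 l
    obtain ⟨r, hr₁, hr₂⟩ := hV (a ≫ p) _ (by rw [Category.assoc]; exact e₁)
    have e₂ : a ≫ p ≫ m Z g = (∑ i ∈ J, q i ≫ φ.map (k i)) ≫ m W ⟨l, hl⟩ := by
      rw [← hr₂, ← Category.assoc, ← hr₁, Category.assoc, Category.assoc, hm' d ⟨l, hl⟩
        ⟨d ≫ l, R.comp_mem d hl⟩ rfl, hm' c g ⟨d ≫ l, R.comp_mem d hl⟩ hcd]
    have e₃ : a ≫ p ≫ φ.map g.1 ≫ Abelian.epiDesc π σ hσ =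
        (∑ i ∈ J, q i ≫ φ.map (k i)) ≫ m W ⟨l, hl⟩ := by
      rw [reassoc_of% hy, Abelian.comp_epiDesc, reassoc_of% ha, Preadditive.sum_comp,
        Preadditive.sum_comp]
      refine Finset.sum_congr rfl fun i hi => ?_
      simp [σ, hm' (k i) ⟨l, hl⟩ ⟨f i, hf i⟩ (hk i hi)]
    rw [Preadditive.comp_sub, Preadditive.comp_sub, e₂, e₃, sub_self]
  · rw [← cancel_epi π]
    ext i
    simp only [π, Sigma.ι_desc_assoc]
    exact (ht _ ⟨f i, hf i⟩).trans (hs i).symm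

/-- The image in `φ X` of an element of `φ Y` factors locally through a member `f` of `R`; a weak
pullback of `g` and `f` lifts the element itself to a member of the pulled back sieve. -/
lemma JointlyEpi.pullback {φ : b ⥤ C} [φ.Additive] (hφ : HasKernelLifts φ) {X Y : b} (g : Y ⟶ X)
    {R : AdditiveSieve X} (hR : JointlyEpi φ R) : JointlyEpi φ (R.pullback g) := by
  have := hasBinaryBiproducts_of_finite_biproducts b
  intro B z hz
  refine hR.eq_zero_of_factors (φ.map g) z fun P p W f hf r hr => ?_
  obtain ⟨V, k, l, hkl, h⟩ := hφ.exists_pullback g f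
  obtain ⟨s, hs, -⟩ := h p r hr
  rw [← hs, Category.assoc, hz k, comp_zero]
  change k ≫ g ∈ R.arrows V
  rw [hkl]
  exact R.comp_mem l hf

/-- The covering system of a functor with kernel lifts to an AB5 category is an additive
Grothendieck topology. -/
def coveringTopology (φ : b ⥤ C) [φ.Additive] (hφ : HasKernelLifts φ) : AdditiveTopology b where
  sieves := coveringSystem φ
  top_mem X := (mem_coveringSystem_iff φ _).2 fun B z hz => by
    simpa using hz (𝟙 X) trivial
  pullback_mem g R hR := by
    rw [mem_coveringSystem_iff] at hR ⊢
    exact hR.pullback hφ g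
  transitive {X R} hR S h := by
    simp only [mem_coveringSystem_iff] at hR h ⊢
    refine fun B z hz => hR z fun Y f hf => h hf _ fun Z g hg => ?_
    rw [← φ.map_comp_assoc]
    exact hz _ hg

end Covering

/-! ### Additive presheaves form an AB5 category. -/

section AdditiveFunctors

variable {b : Type u} [Category.{v} b] [Preadditive b]
  {D : Type u₁} [Category.{v₁} D] [Preadditive D] (K : Type u₂) [Category.{v₂} K]

/-- Additivity is an equation between maps into a pointwise limit, so it is tested on the
projections to additive functors. -/
instance additiveFunctor_isClosedUnderLimitsOfShape [HasLimitsOfShape K D] :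
    (additiveFunctor b D).IsClosedUnderLimitsOfShape K where
  limitsOfShape_le := by
    rintro G ⟨h⟩
    refine ⟨fun {X Y f g} => ?_⟩
    refine (isLimitOfPreserves ((evaluation _ _).obj Y) h.isLimit).hom_ext fun k => ?_
    have : (h.diag.obj k).Additive := h.prop_diag_obj k
    have e (f : X ⟶ Y) := (h.π.app k).naturality f
    dsimp at e ⊢
    rw [e, Functor.map_add, Preadditive.comp_add, Preadditive.add_comp, e, e]

instance additiveFunctor_isClosedUnderColimitsOfShape [HasColimitsOfShape K D] :
    (additiveFunctor b D).IsClosedUnderColimitsOfShape K where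
  colimitsOfShape_le := by
    rintro G ⟨h⟩
    refine ⟨fun {X Y f g} => ?_⟩
    refine (isColimitOfPreserves ((evaluation _ _).obj X) h.isColimit).hom_ext fun k => ?_
    have : (h.diag.obj k).Additive := h.prop_diag_obj k
    have e (f : X ⟶ Y) := (h.ι.app k).naturality f
    dsimp at e ⊢
    rw [← e, Functor.map_add, Preadditive.add_comp, Preadditive.comp_add, e, e]

lemma isClosedUnderKernels_of_limits {A : Type u₁} [Category.{v₁} A] [HasZeroMorphisms A]
    (P : ObjectProperty A) [P.IsClosedUnderLimitsOfShape WalkingParallelPair] :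
    P.IsClosedUnderKernels where
  kernels_le := by
    rintro _ ⟨f, k, hk, hf⟩
    exact P.prop_of_isLimit hk (by rintro (_ | _); exacts [hf.1, hf.2])

lemma isClosedUnderCokernels_of_colimits {A : Type u₁} [Category.{v₁} A] [HasZeroMorphisms A]
    (P : ObjectProperty A) [P.IsClosedUnderColimitsOfShape WalkingParallelPair] :
    P.IsClosedUnderCokernels where
  cokernels_le := by
    rintro _ ⟨f, k, hk, hf⟩
    exact P.prop_of_isColimit hk (by rintro (_ | _); exacts [hf.1, hf.2])

end AdditiveFunctors

section Presheaves

variable {b : Type u} [Category.{w} b] [Preadditive b]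

instance : HasFiniteLimits (PSh b) := ⟨fun _ => inferInstance⟩
instance : HasColimitsOfSize.{w, w} (PSh b) := ⟨fun _ => inferInstance⟩

open ZeroObject in
instance : Abelian (PSh b) :=
  have := isClosedUnderKernels_of_limits (additiveFunctor bᵒᵖ AddCommGrpCat.{w})
  have := isClosedUnderCokernels_of_colimits (additiveFunctor bᵒᵖ AddCommGrpCat.{w})
  have : (additiveFunctor bᵒᵖ AddCommGrpCat.{w}).ContainsZero :=
    ⟨0, isZero_zero _, ⟨((isZero_zero (bᵒᵖ ⥤ AddCommGrpCat.{w})).obj _).eq_of_src _ _⟩⟩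
  have : (additiveFunctor bᵒᵖ AddCommGrpCat.{w}).IsClosedUnderFiniteProducts :=
    ⟨fun _ => inferInstance⟩
  inferInstance

instance : PreservesFiniteLimits (additiveFunctor bᵒᵖ AddCommGrpCat.{w}).ι :=
  ⟨fun _ => inferInstance⟩

instance : AB5OfSize.{w, w} (PSh b) where
  ofShape J _ _ := .domain_of_functor J (additiveFunctor bᵒᵖ AddCommGrpCat.{w}).ι

end Presheaves

/-! ### Additive sheaves form an AB5 category. -/

section Sheaves

variable {b : Type u} [Category.{w} b] [Preadditive b] [HasBinaryBiproducts b]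
  [EssentiallySmall.{w} b] (T : AdditiveTopology b)

/-- The inclusion of additive sheaves into all sheaves of abelian groups. -/
def shToSheaf : Sh T ⥤ Sheaf T.toGrothendieck AddCommGrpCat.{w} where
  obj S := ⟨S.obj.obj, (isSheaf_iff T _).1 S.property⟩
  map f := ⟨f.hom.hom⟩

/-- The functor `shToSheaf` is fully faithful. -/
def shToSheafFullyFaithful : (shToSheaf T).FullyFaithful where
  preimage f := ObjectProperty.homMk (ObjectProperty.homMk f.hom)

/-- The sheafification functor on additive presheaves. -/
def sheafification : PSh b ⥤ Sh T where
  obj F := sheafifyObj T F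
  map f := ObjectProperty.homMk (ObjectProperty.homMk
    ((presheafToSheaf T.toGrothendieck AddCommGrpCat.{w}).map f.hom).hom)

/-- The sheafification of additive presheaves is the restriction of the sheafification of all
presheaves. -/
def sheafificationCompIso :
    (additiveFunctor bᵒᵖ AddCommGrpCat.{w}).ι ⋙
      presheafToSheaf T.toGrothendieck AddCommGrpCat.{w} ≅ sheafification T ⋙ shToSheaf T :=
  NatIso.ofComponents (fun F => Iso.refl _)

/-- The sheafification is left adjoint to the inclusion. -/
def sheafificationAdj : sheafification T ⊣ (isSheaf T).ι :=
  (sheafificationAdjunction T.toGrothendieck AddCommGrpCat.{w}).restrictFullyFaithful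
    (additiveFunctor bᵒᵖ AddCommGrpCat.{w}).fullyFaithfulι
    (shToSheafFullyFaithful T) (sheafificationCompIso T) (Iso.refl _)

/-- After the fully faithful `shToSheaf` this is the sheafification of all presheaves, which is left
exact; fully faithful functors reflect limits. -/
instance : PreservesFiniteLimits (sheafification T) := by
  have := (shToSheafFullyFaithful T).full
  have := (shToSheafFullyFaithful T).faithful
  have : PreservesFiniteLimits (sheafification T ⋙ shToSheaf T) :=
    have := comp_preservesFiniteLimits (additiveFunctor bᵒᵖ AddCommGrpCat.{w}).ι
      (presheafToSheaf T.toGrothendieck AddCommGrpCat.{w})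
    preservesFiniteLimits_of_natIso (sheafificationCompIso T)
  exact ⟨fun J _ _ => preservesLimitsOfShape_of_reflects_of_preserves _ (shToSheaf T)⟩

/-- The left adjoint of the inclusion of sheaves is the sheafification. -/
def leftAdjointIso : (isSheaf T).ι.leftAdjoint ≅ sheafification T :=
  (Adjunction.ofIsRightAdjoint (isSheaf T).ι).leftAdjointUniq (sheafificationAdj T)

instance : PreservesFiniteLimits (isSheaf T).ι.leftAdjoint :=
  preservesFiniteLimits_of_natIso (leftAdjointIso T).symm

instance : Reflective (isSheaf T).ι where
  L := (isSheaf T).ι.leftAdjoint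
  adj := Adjunction.ofIsRightAdjoint _

instance : HasFiniteLimits (Sh T) :=
  ⟨fun _ _ _ => hasLimitsOfShape_of_reflective (isSheaf T).ι⟩

instance : HasColimitsOfSize.{w, w} (Sh T) :=
  ⟨fun _ _ => hasColimitsOfShape_of_reflective (isSheaf T).ι⟩

instance : Abelian (Sh T) :=
  abelianOfAdjunction (isSheaf T).ι (isSheaf T).ι.leftAdjoint
    (asIso (Adjunction.ofIsRightAdjoint (isSheaf T).ι).counit)
    (Adjunction.ofIsRightAdjoint (isSheaf T).ι)

instance : AB5OfSize.{w, w} (Sh T) where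
  ofShape J _ _ := (Adjunction.ofIsRightAdjoint (isSheaf T).ι).hasExactColimitsOfShape J

/-- Restriction to a small model of `b` is faithful, and presheaves on a small category have small
Hom sets. -/
instance : LocallySmall.{w} (PSh b) := by
  let F : PSh b ⥤ (SmallModel.{w} b)ᵒᵖ ⥤ AddCommGrpCat.{w} :=
    (additiveFunctor bᵒᵖ AddCommGrpCat.{w}).ι ⋙
      (Functor.whiskeringLeft _ _ _).obj (equivSmallModel.{w} b).inverse.op
  exact locallySmall_of_faithful F

instance : LocallySmall.{w} (Sh T) := locallySmall_of_faithful (isSheaf T).ι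

lemma isAB5Category_sh : IsAB5Category.{w} (Sh T) where
  exists_abelian := ⟨inferInstance, rfl⟩
  locallySmall := inferInstance
  hasColimits := inferInstance
  ab5 := inferInstance

end Sheaves

/-! ### The additive Yoneda lemma, and additive sieves generated by ordinary covers. -/

section Yoneda

variable {b : Type u} [Category.{w} b] [Preadditive b]

lemma AdditiveSieve.mem_pullback {X Y Z : b} {R : AdditiveSieve X} {f : Y ⟶ X} {g : Z ⟶ Y} :
    g ∈ (R.pullback f).arrows Z ↔ g ≫ f ∈ R.arrows Z := Iff.rfl

/-- The additive Yoneda lemma. -/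
def yonEquiv (X : b) (F : PSh b) : (yon.obj X ⟶ F) ≃ F.obj.obj (op X) where
  toFun α := α.hom.app (op X) (𝟙 X)
  invFun s := ObjectProperty.homMk
    { app Y := AddCommGrpCat.ofHom
        { toFun f := F.obj.map (Quiver.Hom.op f) s
          map_zero' := by
            change F.obj.map (0 : op X ⟶ Y) s = 0
            have := F.property
            rw [F.obj.map_zero]
            rfl
          map_add' f g := by
            change F.obj.map (Quiver.Hom.op f + Quiver.Hom.op g) s = _
            rw [F.property.map_add]
            rfl }
      naturality Y Z f := by
        ext g
        exact ConcreteCategory.congr_hom (F.obj.map_comp (Quiver.Hom.op g) f) s }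
  left_inv α := by
    ext1
    ext Y f
    have := NatTrans.naturality_apply α.hom (Quiver.Hom.op f : op X ⟶ Y) (𝟙 X)
    refine this.symm.trans ?_
    congr 1
    exact Category.comp_id f
  right_inv s := by
    change F.obj.map (𝟙 _) s = s
    simp

/-- A pair `(s, t)` is one section `p` over `X ⊞ X`; restriction along `inl`, `inr` and `inl + inr`
yields `s`, `t` and `s + t`, so naturality alone forces additivity. -/
lemma natural_map_add [HasBinaryBiproducts b] {F G : bᵒᵖ ⥤ AddCommGrpCat.{w}} [F.Additive]
    [G.Additive] (τ : ∀ X : b, F.obj (op X) → G.obj (op X))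
    (hτ : ∀ ⦃X Y : b⦄ (f : Y ⟶ X) (s : F.obj (op X)), τ Y (F.map f.op s) = G.map f.op (τ X s))
    {X : b} (s t : F.obj (op X)) : τ X (s + t) = τ X s + τ X t := by
  let p : F.obj (op (X ⊞ X)) := F.map biprod.fst.op s + F.map biprod.snd.op t
  have h₁ : F.map (biprod.inl : X ⟶ X ⊞ X).op p = s := by
    simp [p, ← ConcreteCategory.comp_apply, ← F.map_comp, ← op_comp]
  have h₂ : F.map (biprod.inr : X ⟶ X ⊞ X).op p = t := by
    simp [p, ← ConcreteCategory.comp_apply, ← F.map_comp, ← op_comp]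
  have h₃ := hτ (biprod.inl + biprod.inr : X ⟶ X ⊞ X) p
  rw [op_add, F.map_add, G.map_add, AddCommGrpCat.hom_add_apply, AddCommGrpCat.hom_add_apply,
    ← hτ, ← hτ,
    h₁, h₂] at h₃
  exact h₃

/-- The additive sieve generated by a sieve. -/
def AdditiveSieve.generate {X : b} (S : Sieve X) : AdditiveSieve X where
  arrows Y := AddSubgroup.closure {f | S f}
  comp_mem {Y Z} g f hf := by
    change f ∈ AddSubgroup.comap (Preadditive.leftComp X g) (AddSubgroup.closure {f | S f})
    refine (AddSubgroup.closure_le _).2 ?_ hf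
    exact fun f hf => AddSubgroup.subset_closure (S.downward_closed hf g)

/-- Passing to the ordinary topology creates no new additive covers: this is what allows local
vanishing there to be read back in `T`. -/
lemma AdditiveTopology.generate_mem {T : AdditiveTopology b} {X : b} {S : Sieve X}
    (hS : S ∈ T.toGrothendieck X) :
    AdditiveSieve.generate S ∈ T.sieves X := by
  induction hS with
  | of X S hS =>
    obtain ⟨R, hR, rfl⟩ := hS
    exact T.mem_of_le hR fun Y f hf => AddSubgroup.subset_closure (Sieve.le_generate _ _ _ hf)
  | top X => exact T.mem_of_le (T.top_mem X) fun Y f _ => AddSubgroup.subset_closure trivial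
  | transitive X R S _ _ ih₁ ih₂ =>
    refine T.transitive ih₁ _ fun Y f hf => ?_
    refine AddSubgroup.closure_induction (p := fun f _ =>
      (AdditiveSieve.generate S).pullback f ∈ T.sieves Y) ?_ ?_ ?_ ?_ hf
    · intro f hf
      refine T.mem_of_le (ih₂ hf) fun Z g hg => ?_
      refine (AddSubgroup.closure_le (K := ((AdditiveSieve.generate S).pullback f).arrows Z)).2
        (fun g hg => ?_) hg
      exact AddSubgroup.subset_closure hg
    · refine T.mem_of_le (T.top_mem Y) fun Z g _ => ?_
      rw [AdditiveSieve.mem_pullback, comp_zero]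
      exact zero_mem _
    -- On the cover where `h ≫ f` lies in the sieve, the condition for `f + g` reduces to the one
    -- for `h ≫ g`.
    · intro f g _ _ hf hg
      refine T.transitive hf _ fun Z h hh => T.mem_of_le (T.pullback_mem h hg) fun W k hk => ?_
      rw [AdditiveSieve.mem_pullback, AdditiveSieve.mem_pullback, Preadditive.comp_add,
        Category.assoc]
      exact add_mem (AdditiveSieve.comp_mem _ k hh) hk
    · intro f _ hf
      refine T.mem_of_le hf fun Z g hg => ?_
      rw [AdditiveSieve.mem_pullback, Preadditive.comp_neg]
      exact neg_mem hg

end Yoneda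

/-! ### The functor `Z`: sections, density and covering system. -/

section Zed

variable {b : Type u} [Category.{w} b] [Preadditive b] [HasBinaryBiproducts b]
  [EssentiallySmall.{w} b] (T : AdditiveTopology b)

/-- Morphisms from `Z X` to a sheaf are sections of the sheaf over `X`. -/
def zedEquiv (X : b) (S : Sh T) : ((zed T).obj X ⟶ S) ≃ S.obj.obj.obj (op X) :=
  ((Adjunction.ofIsRightAdjoint (isSheaf T).ι).homEquiv (yon.obj X) S).trans (yonEquiv X S.obj)

variable {T}

lemma zedEquiv_comp {X : b} {S S' : Sh T} (s : (zed T).obj X ⟶ S) (α : S ⟶ S') :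
    zedEquiv T X S' (s ≫ α) = α.hom.hom.app (op X) (zedEquiv T X S s) := by
  exact congrArg (yonEquiv X S'.obj)
    ((Adjunction.ofIsRightAdjoint (isSheaf T).ι).homEquiv_naturality_right s α)

lemma zedEquiv_map_comp {X Y : b} {S : Sh T} (f : Y ⟶ X) (s : (zed T).obj X ⟶ S) :
    zedEquiv T Y S ((zed T).map f ≫ s) = S.obj.obj.map f.op (zedEquiv T X S s) := by
  refine (congrArg (yonEquiv Y S.obj)
    ((Adjunction.ofIsRightAdjoint (isSheaf T).ι).homEquiv_naturality_left (yon.map f) s)).trans ?_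
  let t := (Adjunction.ofIsRightAdjoint (isSheaf T).ι).homEquiv (yon.obj X) S s
  have h := NatTrans.naturality_apply t.hom f.op (𝟙 X)
  refine Eq.trans ?_ h
  change t.hom.app (op Y) (𝟙 Y ≫ f) = t.hom.app (op Y) (f ≫ 𝟙 X)
  simp

lemma zedEquiv_zero (X : b) (S : Sh T) : zedEquiv T X S 0 = 0 := by
  have := zedEquiv_comp (0 : (zed T).obj X ⟶ S) (0 : S ⟶ S)
  rw [comp_zero] at this
  exact this

lemma zed_ext {S S' : Sh T} {α β : S ⟶ S'}
    (h : ∀ (X : b) (s : (zed T).obj X ⟶ S), s ≫ α = s ≫ β) : α = β := by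
  ext1
  ext1
  ext ⟨X⟩ s
  have := congrArg (zedEquiv T X S') (h X ((zedEquiv T X S).symm s))
  simpa only [zedEquiv_comp, Equiv.apply_symm_apply] using this

/-- A natural family of maps on generalized elements `Z X ⟶ S` comes from a morphism. -/
lemma exists_hom_of_natural {S S' : Sh T}
    (t : ∀ X : b, ((zed T).obj X ⟶ S) → ((zed T).obj X ⟶ S'))
    (ht : ∀ ⦃X Y : b⦄ (f : Y ⟶ X) (s : (zed T).obj X ⟶ S),
      t Y ((zed T).map f ≫ s) = (zed T).map f ≫ t X s) :
    ∃ α : S ⟶ S', ∀ (X : b) (s : (zed T).obj X ⟶ S), s ≫ α = t X s := by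
  let τ : ∀ X : b, S.obj.obj.obj (op X) → S'.obj.obj.obj (op X) :=
    fun X s => zedEquiv T X S' (t X ((zedEquiv T X S).symm s))
  have hτ : ∀ ⦃X Y : b⦄ (f : Y ⟶ X) (s : S.obj.obj.obj (op X)),
      τ Y (S.obj.obj.map f.op s) = S'.obj.obj.map f.op (τ X s) := by
    intro X Y f s
    obtain ⟨s, rfl⟩ := (zedEquiv T X S).surjective s
    simp only [τ, ← zedEquiv_map_comp, Equiv.symm_apply_apply, ht]
  have := S.obj.property
  have := S'.obj.property
  refine ⟨ObjectProperty.homMk (ObjectProperty.homMk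
    { app X := AddCommGrpCat.ofHom (AddMonoidHom.mk' (τ X.unop) fun s s' =>
        natural_map_add τ hτ s s')
      naturality X Y f := by
        ext s
        exact hτ f.unop s }), fun X s => (zedEquiv T X S').injective ?_⟩
  rw [zedEquiv_comp]
  change τ X _ = _
  simp [τ]

/-- A cocone under the objects `Z X ⟶ S` is a natural family of maps on sections, hence a morphism
out of `S`. -/
instance : (zed T).IsDense where
  isDenseAt S := by
    refine ⟨IsColimit.ofExistsUnique fun c => ?_⟩
    obtain ⟨α, hα⟩ := exists_hom_of_natural (fun X s => c.ι.app (CostructuredArrow.mk s)) (by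
      intro X Y f s
      exact (c.w (CostructuredArrow.homMk f : CostructuredArrow.mk ((zed T).map f ≫ s) ⟶
        CostructuredArrow.mk s)).symm)
    refine ⟨α, fun j => ?_, fun β hβ => zed_ext fun X s => ?_⟩
    · simpa using! hα _ j.hom
    · refine Eq.trans ?_ (hα X s).symm
      simpa using! hβ (CostructuredArrow.mk s)

/-- This is uniqueness in the sheaf condition, applied to the zero family. -/
lemma jointlyEpi_zed_of_mem {X : b} {R : AdditiveSieve X} (hR : R ∈ T.sieves X) :
    JointlyEpi (zed T) R := by
  intro B z hz
  apply (zedEquiv T X B).injective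
  rw [zedEquiv_zero]
  obtain ⟨t, -, ht⟩ := B.property hR (fun Y => 0) (fun Y Z g f => by simp)
  refine (ht _ fun Y f => ?_).trans (ht _ fun Y f => ?_).symm
  · have := congrArg (zedEquiv T Y B) (hz f.1 f.2)
    rwa [zedEquiv_map_comp, zedEquiv_zero] at this
  · simp

/-- The quotient of a representable presheaf by a sieve. -/
def AdditiveSieve.quotient {X : b} (R : AdditiveSieve X) : PSh b where
  obj :=
    { obj Y := AddCommGrpCat.of ((Y.unop ⟶ X) ⧸ R.arrows Y.unop)
      map {Y Z} f := AddCommGrpCat.ofHom (QuotientAddGroup.map _ _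
        (Preadditive.leftComp X f.unop) fun g hg => R.comp_mem f.unop hg)
      map_id Y := by
        ext g
        exact congrArg (QuotientAddGroup.mk' _) (Category.id_comp g)
      map_comp {Y Z W} f g := by
        ext h
        exact congrArg (QuotientAddGroup.mk' _) (Category.assoc g.unop f.unop h) }
  property := ⟨fun {Y Z f g} => by
    ext h
    exact congrArg (QuotientAddGroup.mk' _) (Preadditive.add_comp _ _ _ f.unop g.unop h)⟩

/-- The projection to the quotient by a sieve. -/
def AdditiveSieve.toQuotient {X : b} (R : AdditiveSieve X) : yon.obj X ⟶ R.quotient :=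
  ObjectProperty.homMk
    { app Y := AddCommGrpCat.ofHom (QuotientAddGroup.mk' (R.arrows Y.unop)) }

/-- Sheafification kills the projection to `b(-, X) / R`, as the members of `R` do so jointly. Hence
the class of the identity vanishes locally, and the sieve on which it vanishes lies in `R`. -/
lemma mem_of_jointlyEpi_zed {X : b} {R : AdditiveSieve X} (hR : JointlyEpi (zed T) R) :
    R ∈ T.sieves X := by
  have h : (isSheaf T).ι.leftAdjoint.map R.toQuotient = 0 := by
    refine hR _ fun Y f hf => ?_
    have : yon.map f ≫ R.toQuotient = 0 := by
      ext1
      ext Z g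
      exact (QuotientAddGroup.eq_zero_iff _).2 (R.comp_mem g hf)
    refine ((isSheaf T).ι.leftAdjoint.map_comp _ _).symm.trans ?_
    rw [this, Functor.map_zero]
    rfl
  have h' : (sheafification T).map R.toQuotient = 0 := by
    rw [← cancel_epi ((leftAdjointIso T).hom.app _), ← (leftAdjointIso T).hom.naturality, h]
    simp
  have h'' : sheafifyMap T.toGrothendieck R.toQuotient.hom = 0 := congrArg (·.hom.hom) h'
  have h₃ : (toSheafify T.toGrothendieck R.quotient.obj).app (op X)
      (QuotientAddGroup.mk' _ (𝟙 X)) = 0 := by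
    have h₄ : R.toQuotient.hom ≫ toSheafify T.toGrothendieck R.quotient.obj = 0 := by
      rw [toSheafify_naturality, h'', comp_zero]
    have h₅ := congrArg (fun α => α.app (op X)) h₄
    exact congrArg (fun α => α.hom (𝟙 X)) h₅
  have := Presheaf.equalizerSieve_mem T.toGrothendieck (toSheafify T.toGrothendieck R.quotient.obj)
    (X := op X) (QuotientAddGroup.mk' _ (𝟙 X)) 0 (h₃.trans (map_zero _).symm)
  refine T.mem_of_le (T.generate_mem this) fun Y f hf => ?_
  refine (AddSubgroup.closure_le (K := R.arrows Y)).2 (fun f hf => ?_) hf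
  have h₄ : R.quotient.obj.map f.op (QuotientAddGroup.mk' _ (𝟙 X)) = R.quotient.obj.map f.op 0 := hf
  rw [map_zero] at h₄
  have h₅ := (QuotientAddGroup.eq_zero_iff (N := R.arrows Y) (f ≫ 𝟙 X)).1 h₄
  rwa [Category.comp_id] at h₅

lemma coveringSystem_zed (T : AdditiveTopology b) : coveringSystem (zed T) = T.sieves := by
  ext X R
  rw [mem_coveringSystem_iff]
  exact ⟨mem_of_jointlyEpi_zed, jointlyEpi_zed_of_mem⟩

end Zed

/-! ### Presentation of a sheaf by its sections. -/

section FiniteSums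

variable {b : Type u} [Category.{w} b] [Preadditive b] [HasBinaryBiproducts b]
  [HasFiniteBiproducts b] [EssentiallySmall.{w} b] {T : AdditiveTopology b}

/-- The given sections are the components of one section over the direct sum of their domains. -/
lemma exists_common_section {S : Sh T} {I : Type*} (J : Finset I) (X : I → b)
    (s : ∀ i, (zed T).obj (X i) ⟶ S) :
    ∃ (W : b) (k : ∀ i, X i ⟶ W) (t : (zed T).obj W ⟶ S),
      ∀ i ∈ J, (zed T).map (k i) ≫ t = s i := by
  classical
  refine ⟨⨁ fun i : J => X i,
    fun i => if h : i ∈ J then biproduct.ι (fun i : J => X i) ⟨i, h⟩ else 0,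
    ∑ i : J, (zed T).map (biproduct.π (fun i : J => X i) i) ≫ s i, fun i hi => ?_⟩
  have : (if h : i ∈ J then biproduct.ι (fun i : J => X i) ⟨i, h⟩ else 0) =
    biproduct.ι (fun i : J => X i) ⟨i, hi⟩ := dif_pos hi
  simp only [this]
  rw [Preadditive.comp_sum, Finset.sum_eq_single ⟨i, hi⟩]
  · simp [← (zed T).map_comp_assoc]
  · intro j _ hj
    rw [← (zed T).map_comp_assoc, biproduct.ι_π_ne _ hj.symm]
    simp
  · simp

end FiniteSums

section LocalLifting

variable {b : Type u} [Category.{w} b] [Preadditive b] [HasBinaryBiproducts b]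
  [EssentiallySmall.{w} b] {T : AdditiveTopology b}

/-- The sieve of the morphisms that annihilate a section of a sheaf. -/
def annihilator {S : Sh T} {X : b} (s : (zed T).obj X ⟶ S) : AdditiveSieve X where
  arrows Y :=
    { carrier := {f | (zed T).map f ≫ s = 0}
      zero_mem' := by simp
      add_mem' := by
        intro f g (hf : _ = _) (hg : _ = _)
        simp [Preadditive.add_comp, hf, hg]
      neg_mem' := by
        intro f (hf : _ = _)
        simp [Preadditive.neg_comp, hf] }
  comp_mem g f hf := by
    change (zed T).map (g ≫ f) ≫ s = 0
    rw [Functor.map_comp, Category.assoc, show (zed T).map f ≫ s = 0 from hf, comp_zero]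

lemma mem_annihilator {S : Sh T} {X Y : b} (s : (zed T).obj X ⟶ S) (f : Y ⟶ X) :
    f ∈ (annihilator s).arrows Y ↔ (zed T).map f ≫ s = 0 := Iff.rfl

/-- A small category indexing the sections of a sheaf. -/
abbrev SectionIndex (S : Sh T) : Type w := SmallModel.{w} (CostructuredArrow (zed T) S)

/-- The object over which a section is defined. -/
def sectionObj {S : Sh T} (e : SectionIndex S) : b :=
  ((equivSmallModel.{w} (CostructuredArrow (zed T) S)).inverse.obj e).left

/-- The section with a given index. -/
def sectionHom {S : Sh T} (e : SectionIndex S) : (zed T).obj (sectionObj e) ⟶ S :=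
  ((equivSmallModel.{w} (CostructuredArrow (zed T) S)).inverse.obj e).hom

/-- The set of restriction relations between sections. -/
abbrev RelationIndex (S : Sh T) : Type w := Σ e e' : SectionIndex S, e ⟶ e'

/-- The morphism along which a section is restricted. -/
def relationHom {S : Sh T} (r : RelationIndex S) : sectionObj r.1 ⟶ sectionObj r.2.1 :=
  ((equivSmallModel.{w} (CostructuredArrow (zed T) S)).inverse.map r.2.2).left

lemma map_relationHom_sectionHom {S : Sh T} (r : RelationIndex S) :
    (zed T).map (relationHom r) ≫ sectionHom r.2.1 = sectionHom r.1 :=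
  CostructuredArrow.w ((equivSmallModel.{w} (CostructuredArrow (zed T) S)).inverse.map r.2.2)

/-- The small index category contains `s` only up to isomorphism; the retraction `i ≫ p = 𝟙 X` is
all that is used of it. -/
lemma exists_sectionHom {S : Sh T} {X : b} (s : (zed T).obj X ⟶ S) :
    ∃ (e : SectionIndex S) (p : sectionObj e ⟶ X) (i : X ⟶ sectionObj e), i ≫ p = 𝟙 X ∧
      (zed T).map p ≫ s = sectionHom e ∧ (zed T).map i ≫ sectionHom e = s := by
  let E := equivSmallModel.{w} (CostructuredArrow (zed T) S)
  let j := E.unitIso.app (CostructuredArrow.mk s)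
  refine ⟨E.functor.obj (CostructuredArrow.mk s), j.inv.left, j.hom.left, ?_,
    CostructuredArrow.w j.inv, CostructuredArrow.w j.hom⟩
  exact congrArg CommaMorphism.left j.hom_inv_id

variable {C : Type u₁} [Category.{v₁} C] (F : Sh T ⥤ C)

/-- Compatible families on the sections of a sheaf `S` define morphisms from `F S`. -/
lemma existsUnique_desc_sections [PreservesColimitsOfSize.{w, w} F] (S : Sh T) {A : C}
    (k : ∀ e : SectionIndex S, F.obj ((zed T).obj (sectionObj e)) ⟶ A)
    (hk : ∀ r : RelationIndex S, F.map ((zed T).map (relationHom r)) ≫ k r.2.1 = k r.1) :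
    ∃! m : F.obj S ⟶ A, ∀ e, F.map (sectionHom e) ≫ m = k e := by
  let c₀ := Cocone.whisker (equivSmallModel.{w} (CostructuredArrow (zed T) S)).symm.functor
      ((Functor.LeftExtension.mk (𝟭 (Sh T)) (zed T).rightUnitor.inv).coconeAt S)
  have hc : IsColimit (F.mapCocone c₀) := isColimitOfPreserves F
    (((zed T).denseAt S).whiskerEquivalence
      (equivSmallModel.{w} (CostructuredArrow (zed T) S)).symm)
  have hι : ∀ e, (F.mapCocone c₀).ι.app e = F.map (sectionHom e) :=
    fun e => congrArg F.map (Category.id_comp _)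
  let c : Cocone (((equivSmallModel.{w} (CostructuredArrow (zed T) S)).symm.functor ⋙
      CostructuredArrow.proj (zed T) S ⋙ zed T) ⋙ F) :=
    ⟨A, { app e := k e
          naturality e e' f := (hk ⟨e, e', f⟩).trans (Category.comp_id _).symm }⟩
  exact ⟨hc.desc c, fun e => (congrArg (· ≫ hc.desc c) (hι e).symm).trans (hc.fac c e),
    fun m hm => hc.uniq c m fun e => (congrArg (· ≫ m) (hι e)).trans (hm e)⟩

variable [Preadditive C] [HasCoproducts.{w} C]

/-- The image under `F` of the relations between the sections of a sheaf. -/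
def relations (S : Sh T) :
    ∐ (fun r : RelationIndex S => F.obj ((zed T).obj (sectionObj r.1))) ⟶
      ∐ (fun e : SectionIndex S => F.obj ((zed T).obj (sectionObj e))) :=
  Sigma.desc fun r => F.map ((zed T).map (relationHom r)) ≫ Sigma.ι
    (fun e : SectionIndex S => F.obj ((zed T).obj (sectionObj e))) r.2.1 -
      Sigma.ι (fun e : SectionIndex S => F.obj ((zed T).obj (sectionObj e))) r.1

/-- The image under `F` of the map from the coproduct of the generators to a sheaf. -/
def generators (S : Sh T) :
    ∐ (fun e : SectionIndex S => F.obj ((zed T).obj (sectionObj e))) ⟶ F.obj S :=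
  Sigma.desc fun e => F.map (sectionHom e)

lemma relations_generators (S : Sh T) : relations F S ≫ generators F S = 0 := by
  ext r
  simp [relations, generators, Preadditive.sub_comp, ← F.map_comp, map_relationHom_sectionHom]

/-- A functor that preserves small colimits preserves the presentation of a sheaf by its
sections. -/
def isColimitGenerators [PreservesColimitsOfSize.{w, w} F] (S : Sh T) :
    IsColimit (CokernelCofork.ofπ (generators F S) (relations_generators F S)) := by
  have H : ∀ {A : C} (k : ∐ (fun e : SectionIndex S => F.obj ((zed T).obj (sectionObj e))) ⟶ A),
      relations F S ≫ k = 0 → ∃! m : F.obj S ⟶ A, generators F S ≫ m = k := by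
    intro A k hk
    obtain ⟨m, hm, hm'⟩ := existsUnique_desc_sections F S (fun e => Sigma.ι
      (fun e : SectionIndex S => F.obj ((zed T).obj (sectionObj e))) e ≫ k) (fun r => by
      have := Sigma.ι (fun r : RelationIndex S => F.obj ((zed T).obj (sectionObj r.1))) r ≫= hk
      simpa [relations, Preadditive.sub_comp, sub_eq_zero] using this)
    refine ⟨m, ?_, fun m' h => hm' m' fun e => ?_⟩
    · ext e
      simpa [generators] using hm e
    · rw [← h]
      simp [generators]
  exact CokernelCofork.IsColimit.ofπ _ _ (fun k hk => (H k hk).choose)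
    (fun k hk => (H k hk).choose_spec.1) (fun k hk m hm => (H k hk).choose_spec.2 m hm)

end LocalLifting

/-! ### Exactness and faithfulness of cocontinuous functors on sheaves. -/

section Exactness

variable {b : Type u} [Category.{w} b] [Preadditive b] [HasBinaryBiproducts b]
  [HasFiniteBiproducts b] [EssentiallySmall.{w} b] {T : AdditiveTopology b}
  {C : Type u₁} [Category.{v₁} C] [Abelian C]
  [HasColimitsOfSize.{w, w} C] [AB5OfSize.{w, w} C] (F : Sh T ⥤ C)
  [PreservesColimitsOfSize.{w, w} F]

/-- Generalized elements of `F S` come locally from sections of `S`. -/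
lemma eq_zero_of_sections {S : Sh T} {A B : C} (y : A ⟶ F.obj S) (z : A ⟶ B)
    (h : ∀ ⦃P : C⦄ (p : P ⟶ A) ⦃X : b⦄ (s : (zed T).obj X ⟶ S) (r : P ⟶ F.obj ((zed T).obj X)),
      p ≫ y = r ≫ F.map s → p ≫ z = 0) : z = 0 := by
  have : Epi (generators F S) := Cofork.IsColimit.epi (isColimitGenerators F S)
  obtain ⟨A', π, _, y', hy'⟩ := surjective_up_to_refinements_of_epi (generators F S) y
  rw [← cancel_epi π, comp_zero]
  refine eq_zero_of_finite_sums y' _ fun P p J q hp => ?_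
  obtain ⟨W, k, t, ht⟩ := exists_common_section J _ (sectionHom (S := S))
  rw [← Category.assoc]
  refine h (p ≫ π) t (∑ i ∈ J, q i ≫ F.map ((zed T).map (k i))) ?_
  rw [Category.assoc, hy', reassoc_of% hp, Preadditive.sum_comp, Preadditive.sum_comp]
  refine Finset.sum_congr rfl fun i hi => ?_
  simp [generators, ← F.map_comp, ht i hi]

variable [F.Additive]

/-- Generalized elements of the kernel of `F s` come locally from morphisms that annihilate the
section `s`. -/
lemma eq_zero_of_annihilator (hF : HasKernelLifts (zed T ⋙ F)) {S : Sh T} {X : b}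
    (s : (zed T).obj X ⟶ S) {A B : C} (x : A ⟶ F.obj ((zed T).obj X)) (hx : x ≫ F.map s = 0)
    (z : A ⟶ B)
    (h : ∀ ⦃P : C⦄ (p : P ⟶ A) ⦃Y : b⦄ (k : Y ⟶ X) (_ : (zed T).map k ≫ s = 0)
      (r : P ⟶ F.obj ((zed T).obj Y)), p ≫ x = r ≫ F.map ((zed T).map k) → p ≫ z = 0) :
    z = 0 := by
  classical
  obtain ⟨e₀, pr, i, hi, hpr, hi'⟩ := exists_sectionHom s
  let D : SectionIndex S → C := fun e => F.obj ((zed T).obj (sectionObj e))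
  let x' : A ⟶ D e₀ := x ≫ F.map ((zed T).map i)
  have hx' : (x' ≫ Sigma.ι D e₀) ≫ generators F S = 0 := by
    simp [x', D, generators, ← F.map_comp, hi', hx]
  -- `generators` is a cokernel of `relations`, so `x'` is locally a combination of relations.
  obtain ⟨A', π, _, y, hy⟩ := (ShortComplex.exact_of_g_is_cokernel
    (ShortComplex.mk _ _ (relations_generators F S)) (isColimitGenerators F S)
    ).exact_up_to_refinements (x' ≫ Sigma.ι D e₀) hx'
  rw [← cancel_epi π, comp_zero]
  refine eq_zero_of_finite_sums y _ fun P p J q hp => ?_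
  -- One section `t` restricts to the section of index `e₀` and to all those occurring in the finite
  -- combination.
  obtain ⟨W, k, t, ht⟩ := exists_common_section
    (insert e₀ (J.image (fun r => r.1) ∪ J.image (fun r => r.2.1))) _ (sectionHom (S := S))
  -- Mapped to `W`, each relation becomes a morphism that annihilates `t`; finitely many of them
  -- factor through one `g`.
  obtain ⟨V, l, g, hg, hl⟩ := (annihilator t).exists_factor J (fun r => sectionObj r.1)
    (fun r => relationHom r ≫ k r.2.1 - k r.1) (by
      intro r hr
      rw [mem_annihilator, Functor.map_sub, Preadditive.sub_comp, Functor.map_comp,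
        Category.assoc, ht, ht, map_relationHom_sectionHom, sub_self]
      · exact Finset.mem_insert_of_mem
          (Finset.mem_union_left _ (Finset.mem_image_of_mem (fun r => r.1) hr))
      · exact Finset.mem_insert_of_mem
          (Finset.mem_union_right _ (Finset.mem_image_of_mem (fun r => r.2.1) hr)))
  have key : (p ≫ π ≫ x') ≫ (zed T ⋙ F).map (k e₀) =
      (∑ r ∈ J, q r ≫ (zed T ⋙ F).map (l r)) ≫ (zed T ⋙ F).map g := by
    let ρ : ∐ D ⟶ F.obj ((zed T).obj W) := Sigma.desc fun e => F.map ((zed T).map (k e))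
    have h₁ : p ≫ π ≫ x' ≫ Sigma.ι D e₀ = (∑ r ∈ J, q r ≫ Sigma.ι
        (fun r : RelationIndex S => F.obj ((zed T).obj (sectionObj r.1))) r) ≫ relations F S := by
      rw [hy, ← hp, Category.assoc]
    have h₂ := h₁ =≫ ρ
    simp only [Category.assoc, ρ, Sigma.ι_desc] at h₂
    rw [Category.assoc, Category.assoc]
    refine h₂.trans ?_
    rw [Preadditive.sum_comp, Preadditive.sum_comp]
    refine Finset.sum_congr rfl fun r hr => ?_
    rw [Category.assoc, Category.assoc, ← Functor.map_comp, hl r hr]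
    simp [relations, D, Preadditive.sub_comp, Functor.map_sub]
  -- As `c ≫ k e₀` factors through `g`, it annihilates `t`; hence `c` annihilates the section of
  -- index `e₀`, and `c ≫ pr` annihilates `s`.
  obtain ⟨K, c, d, hcd, hK⟩ := hF.exists_pullback (k e₀) g
  obtain ⟨r, hr, -⟩ := hK _ _ key
  rw [← Category.assoc]
  refine h (p ≫ π) (c ≫ pr) ?_ r ?_
  · rw [Functor.map_comp, Category.assoc, hpr, ← ht e₀ (Finset.mem_insert_self _ _),
      ← Functor.map_comp_assoc, hcd, Functor.map_comp_assoc, (mem_annihilator t g).1 hg, comp_zero]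
  · have h₃ := hr =≫ F.map ((zed T).map pr)
    have h₄ : F.map ((zed T).map i) ≫ F.map ((zed T).map pr) = 𝟙 _ := by
      rw [← F.map_comp, ← Functor.map_comp, hi, (zed T).map_id, F.map_id]
    simp only [Category.assoc, x', h₄, Category.comp_id, Functor.comp_map] at h₃
    rw [Functor.map_comp, Functor.map_comp, h₃, Category.assoc]

/-- An element killed by `F i` comes locally from a section `s`, and then from some `k` with `k ≫ s
≫ i = 0`; since `i` is mono, `k` annihilates `s` already. -/
lemma map_mono_of_hasKernelLifts (hF : HasKernelLifts (zed T ⋙ F)) {S' S : Sh T} (i : S' ⟶ S)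
    [Mono i] : Mono (F.map i) := by
  refine Preadditive.mono_of_cancel_zero _ fun {A} y hy => ?_
  refine eq_zero_of_sections F y y fun P p X s r hr => ?_
  rw [hr]
  refine eq_zero_of_annihilator F hF (s ≫ i) r ?_ _ fun P' p' Y k hk r' hr' => ?_
  · rw [F.map_comp, ← Category.assoc, ← hr, Category.assoc, hy, comp_zero]
  · have hk' : (zed T).map k ≫ s = 0 := zero_of_comp_mono i (by rw [Category.assoc, hk])
    rw [reassoc_of% hr', ← F.map_comp, hk', Functor.map_zero, comp_zero]

lemma preservesFiniteLimits_of_hasKernelLifts (hF : HasKernelLifts (zed T ⋙ F)) :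
    PreservesFiniteLimits F := by
  have : PreservesFiniteColimits F := PreservesColimitsOfSize.preservesFiniteColimits.{w, w} F
  rw [Functor.preservesFiniteLimits_iff_forall_exact_map_and_mono]
  intro S hS
  have := hS.mono_f
  exact ⟨((Functor.preservesFiniteColimits_iff_forall_exact_map_and_epi F).1 inferInstance S hS).1,
    map_mono_of_hasKernelLifts F hF S.f⟩

/-- If `F` kills a section, the annihilator of the section is covering for `zed T ⋙ F`, hence
belongs to `T`, and the section vanishes. -/
lemma faithful_of_hasKernelLifts (hF : HasKernelLifts (zed T ⋙ F))
    (h : ∀ ⦃X : b⦄ (R : AdditiveSieve X), JointlyEpi (zed T ⋙ F) R → R ∈ T.sieves X) :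
    F.Faithful where
  map_injective {S S' α β} hαβ := by
    refine zed_ext fun X s => ?_
    rw [← sub_eq_zero, ← Preadditive.comp_sub]
    have h₀ : F.map (s ≫ (α - β)) = 0 := by
      rw [F.map_comp, F.map_sub, hαβ, sub_self, comp_zero]
    refine jointlyEpi_zed_of_mem (h (annihilator (s ≫ (α - β))) fun B z hz => ?_) _
      fun Y f hf => hf
    refine eq_zero_of_annihilator F hF (s ≫ (α - β)) (𝟙 _) (by rw [h₀, comp_zero]) z
      fun P p Y k hk r hr => ?_
    rw [Category.comp_id] at hr
    rw [hr, Category.assoc]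
    exact (congrArg (r ≫ ·) (hz k hk)).trans comp_zero

end Exactness

/-! ### Nerve and realization: extending a functor to sheaves. -/

section Nerve

variable {b : Type u} [Category.{w} b] [Preadditive b]
  {C : Type u₁} [Category.{v₁} C] [Preadditive C]

lemma HasKernelLifts.of_iso {φ ψ : b ⥤ C}
    (e : φ ≅ ψ) (hφ : HasKernelLifts φ) : HasKernelLifts ψ := by
  intro X Y f
  obtain ⟨W, k, hk, h⟩ := hφ f
  refine ⟨W, k, hk, fun A x hx => ?_⟩
  obtain ⟨r, hr⟩ := h (x ≫ e.inv.app Y) (by rw [Category.assoc, ← e.inv.naturality,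
    reassoc_of% hx, zero_comp])
  refine ⟨r ≫ e.hom.app W, ?_⟩
  rw [Category.assoc, ← e.hom.naturality, reassoc_of% hr]
  simp

variable [LocallySmall.{w} C]

/-- The presheaf `C(φ -, B)`. -/
def nervePSh (φ : b ⥤ C) [φ.Additive] : C ⥤ PSh b :=
  (additiveFunctor bᵒᵖ AddCommGrpCat.{w}).lift
    (ShrinkHoms.functor.{w} C ⋙ preadditiveYoneda ⋙
      (Functor.whiskeringLeft _ _ _).obj (φ ⋙ ShrinkHoms.functor.{w} C).op)
    (fun B => inferInstanceAs ((φ ⋙ ShrinkHoms.functor.{w} C).op ⋙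
      preadditiveYoneda.obj ((ShrinkHoms.functor.{w} C).obj B)).Additive)

/-- The sections of `C(φ -, B)` over `X` are the morphisms from `φ X` to `B`. -/
def nervePShEquiv (φ : b ⥤ C) [φ.Additive] (X : b) (B : C) :
    (φ.obj X ⟶ B) ≃ ((nervePSh φ).obj B).obj.obj (op X) :=
  (ShrinkHoms.equivalence.{w} C).fullyFaithfulFunctor.homEquiv

lemma nervePShEquiv_map_comp {φ : b ⥤ C} [φ.Additive] {X Y : b} {B : C} (f : Y ⟶ X)
    (x : φ.obj X ⟶ B) : nervePShEquiv φ Y B (φ.map f ≫ x) =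
      ((nervePSh φ).obj B).obj.map f.op (nervePShEquiv φ X B x) :=
  (ShrinkHoms.functor.{w} C).map_comp _ _

lemma nervePShEquiv_comp {φ : b ⥤ C} [φ.Additive] {X : b} {B B' : C} (x : φ.obj X ⟶ B)
    (g : B ⟶ B') : nervePShEquiv φ X B' (x ≫ g) =
      ((nervePSh φ).map g).hom.app (op X) (nervePShEquiv φ X B x) :=
  (ShrinkHoms.functor.{w} C).map_comp _ _

end Nerve

section Realization

variable {b : Type u} [Category.{w} b] [Preadditive b]
  [HasFiniteBiproducts b] [EssentiallySmall.{w} b] {T : AdditiveTopology b}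
  {C : Type u₁} [Category.{v₁} C] [LocallySmall.{w} C] [Abelian C]
  [HasColimitsOfSize.{w, w} C] [AB5OfSize.{w, w} C]

/-- The sheaf condition for `C(φ -, B)` is the gluing of `JointlyEpi.existsUnique_desc`. -/
lemma isSheaf_nervePSh {φ : b ⥤ C} [φ.Additive] (hφ : HasKernelLifts φ)
    (hT : ∀ ⦃X : b⦄ ⦃R : AdditiveSieve X⦄, R ∈ T.sieves X → JointlyEpi φ R) (B : C) :
    isSheaf T ((nervePSh φ).obj B) := by
  intro X R hR m hm
  obtain ⟨s, hs, hs'⟩ := (hT hR).existsUnique_desc hφ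
    (fun Y f => (nervePShEquiv φ Y B).symm (m Y f)) (fun Y Z g f => by
      rw [hm, Equiv.symm_apply_eq, nervePShEquiv_map_comp, Equiv.apply_symm_apply])
  refine ⟨nervePShEquiv φ X B s, fun Y f => ?_, fun t ht => ?_⟩
  · rw [← nervePShEquiv_map_comp, hs, Equiv.apply_symm_apply]
  · rw [← Equiv.symm_apply_eq]
    refine hs' _ fun Y f => ?_
    rw [Equiv.eq_symm_apply, nervePShEquiv_map_comp, Equiv.apply_symm_apply, ht]

variable [HasBinaryBiproducts b] (φ : b ⥤ C) [φ.Additive] (hφ : HasKernelLifts φ)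
    (hT : ∀ ⦃X : b⦄ ⦃R : AdditiveSieve X⦄, R ∈ T.sieves X → JointlyEpi φ R)

/-- The sheaf `C(φ -, B)`. -/
def nerve : C ⥤ Sh T := (isSheaf T).lift (nervePSh φ) (isSheaf_nervePSh hφ hT)

/-- Morphisms from `Z X` to the sheaf `C(φ -, B)` are morphisms from `φ X` to `B`. -/
def nerveEquiv (X : b) (B : C) : (φ.obj X ⟶ B) ≃ ((zed T).obj X ⟶ (nerve φ hφ hT).obj B) :=
  (nervePShEquiv φ X B).trans (zedEquiv T X ((nerve φ hφ hT).obj B)).symm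

lemma zedEquiv_nerveEquiv {X : b} {B : C} (x : φ.obj X ⟶ B) :
    zedEquiv T X _ (nerveEquiv φ hφ hT X B x) = nervePShEquiv φ X B x :=
  Equiv.apply_symm_apply _ _

lemma nerveEquiv_map_comp {X Y : b} {B : C} (f : Y ⟶ X) (x : φ.obj X ⟶ B) :
    nerveEquiv φ hφ hT Y B (φ.map f ≫ x) = (zed T).map f ≫ nerveEquiv φ hφ hT X B x := by
  apply (zedEquiv T Y _).injective
  rw [zedEquiv_map_comp, zedEquiv_nerveEquiv, zedEquiv_nerveEquiv, nervePShEquiv_map_comp]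
  rfl

lemma nerveEquiv_comp {X : b} {B B' : C} (x : φ.obj X ⟶ B) (g : B ⟶ B') :
    nerveEquiv φ hφ hT X B' (x ≫ g) =
      nerveEquiv φ hφ hT X B x ≫ (nerve φ hφ hT).map g := by
  apply (zedEquiv T X _).injective
  rw [zedEquiv_comp, zedEquiv_nerveEquiv, zedEquiv_nerveEquiv, nervePShEquiv_comp]
  rfl

/-- At `Z X` the left adjoint is `φ X`; by density every sheaf is an essentially small colimit of
such objects, and `C` has these colimits. -/
instance isRightAdjoint_nerve : (nerve φ hφ hT).IsRightAdjoint := by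
  refine Functor.isRightAdjoint_of_leftAdjointObjIsDefined_eq_top ?_
  ext S
  simp only [Pi.top_apply, Prop.top_eq_true, iff_true]
  have : HasColimitsOfShape (CostructuredArrow (zed T) S) C :=
    hasColimitsOfShape_of_essentiallySmall.{w} _ _
  refine Functor.leftAdjointObjIsDefined_of_isColimit ((zed T).denseAt S) fun j => ?_
  have : (nerve φ hφ hT ⋙ coyoneda.obj (op ((zed T).obj j.left))).CorepresentableBy
      (φ.obj j.left) :=
    { homEquiv := fun {B} => nerveEquiv φ hφ hT j.left B
      homEquiv_comp := fun g x => nerveEquiv_comp φ hφ hT x g }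
  exact this.isCorepresentable

/-- The cocontinuous extension of `φ` to sheaves. -/
def realization : Sh T ⥤ C := (nerve φ hφ hT).leftAdjoint

/-- The adjunction between the extension of `φ` and the nerve. -/
def realizationAdj : realization φ hφ hT ⊣ nerve φ hφ hT := Adjunction.ofIsRightAdjoint _

instance : (realization φ hφ hT).IsLeftAdjoint := (realizationAdj φ hφ hT).isLeftAdjoint

instance : (realization φ hφ hT).Additive :=
  rightExactFunctor_le_additiveFunctor _ _ _
    (inferInstanceAs (PreservesFiniteColimits (realization φ hφ hT)))

/-- The extension of `φ` to sheaves extends `φ`. -/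
def zedCompRealization : zed T ⋙ realization φ hφ hT ≅ φ := by
  let τ : zed T ⋙ realization φ hφ hT ⟶ φ :=
    { app X := ((realizationAdj φ hφ hT).homEquiv _ _).symm (nerveEquiv φ hφ hT X _ (𝟙 _))
      naturality X Y f := by
        rw [Functor.comp_map, ← Adjunction.homEquiv_naturality_left_symm, ← nerveEquiv_map_comp,
          ← Adjunction.homEquiv_naturality_right_symm, ← nerveEquiv_comp, Category.comp_id,
          Category.id_comp] }
  have : ∀ X, IsIso (τ.app X) := fun X => by
    refine isIso_of_coyoneda_map_bijective _ fun B => ?_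
    have : (fun x : φ.obj X ⟶ B => τ.app X ≫ x) =
        ((realizationAdj φ hφ hT).homEquiv _ _).symm ∘ nerveEquiv φ hφ hT X B := by
      ext x
      simp only [τ, ← Adjunction.homEquiv_naturality_right_symm, ← nerveEquiv_comp,
        Category.id_comp, Function.comp]
    rw [this]
    exact (((realizationAdj φ hφ hT).homEquiv _ _).symm.bijective).comp
      (nerveEquiv φ hφ hT X B).bijective
  have : IsIso τ := NatIso.isIso_of_isIso_app τ
  exact asIso τ

/-- Kernel lifts give exactness; faithfulness uses that `φ` has no covering sieves outside `T`. -/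
lemma isAB5Functor_realization (h : coveringSystem φ = T.sieves) :
    isAB5Functor.{w} (Sh T) C (realization φ hφ hT) := by
  have h₁ : HasKernelLifts (zed T ⋙ realization φ hφ hT) :=
    hφ.of_iso (zedCompRealization φ hφ hT).symm
  have : PreservesColimitsOfSize.{w, w} (realization φ hφ hT) :=
    (realizationAdj φ hφ hT).leftAdjoint_preservesColimits
  refine ⟨inferInstance, faithful_of_hasKernelLifts _ h₁ fun X R hR => ?_,
    preservesFiniteLimits_of_hasKernelLifts _ h₁,
    PreservesColimitsOfSize.preservesFiniteColimits.{w, w} _, this⟩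
  rw [← h, ← coveringSystem_congr (zedCompRealization φ hφ hT), mem_coveringSystem_iff]
  exact hR

end Realization

/-! ### Morphisms and kernels in `Noy a`, and left exact functors on it. -/

section NoyMorphisms

variable {a : Type u} [Category.{w} a] [Preadditive a]

/-- The object of `Noy a` given by a morphism of `a`. -/
def Noy.mk {A B : a} (f : A ⟶ B) : Noy a := (Noy.quotient a).obj (Arrow.mk f)

lemma Noy.exists_eq_mk (X : Noy a) : ∃ (A B : a) (f : A ⟶ B), X = Noy.mk f :=
  ⟨_, _, X.as.hom, rfl⟩

/-- The morphism of `Noy a` given by a commutative square. -/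
def Noy.homMk {A B A' B' : a} {f : A ⟶ B} {f' : A' ⟶ B'} (α : A ⟶ A') (β : B ⟶ B')
    (w : α ≫ f' = f ≫ β) : Noy.mk f ⟶ Noy.mk f' :=
  (Noy.quotient a).map (Arrow.homMk (f := Arrow.mk f) (g := Arrow.mk f') α β w)

lemma Noy.exists_eq_homMk {A B A' B' : a} {f : A ⟶ B} {f' : A' ⟶ B'} (g : Noy.mk f ⟶ Noy.mk f') :
    ∃ (α : A ⟶ A') (β : B ⟶ B') (w : α ≫ f' = f ≫ β), g = Noy.homMk α β w := by
  obtain ⟨γ, rfl⟩ := (Noy.quotient a).map_surjective g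
  exact ⟨γ.left, γ.right, γ.w, rfl⟩

lemma Noy.homMk_comp {A B A' B' A'' B'' : a} {f : A ⟶ B} {f' : A' ⟶ B'} {f'' : A'' ⟶ B''}
    (α : A ⟶ A') (β : B ⟶ B') (w : α ≫ f' = f ≫ β) (α' : A' ⟶ A'') (β' : B' ⟶ B'')
    (w' : α' ≫ f'' = f' ≫ β') :
    Noy.homMk α β w ≫ Noy.homMk α' β' w' = Noy.homMk (α ≫ α') (β ≫ β')
      (by rw [Category.assoc, w', ← Category.assoc, w, Category.assoc]) :=
  ((Noy.quotient a).map_comp _ _).symm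

lemma Noy.homMk_eq_homMk_iff {A B A' B' : a} {f : A ⟶ B} {f' : A' ⟶ B'} {α α' : A ⟶ A'}
    {β β' : B ⟶ B'} {w : α ≫ f' = f ≫ β} {w' : α' ≫ f' = f ≫ β'} :
    Noy.homMk α β w = Noy.homMk α' β' w' ↔ ∃ h : B ⟶ A', α - α' = f ≫ h := by
  refine (Quotient.functor_map_eq_iff _ _ _).trans ⟨fun ⟨h⟩ => ⟨h.hom, h.comm⟩, fun ⟨h, e⟩ => ?_⟩
  exact ⟨⟨h, e⟩⟩

lemma Noy.homMk_congr {A B A' B' : a} {f : A ⟶ B} {f' : A' ⟶ B'} {α α' : A ⟶ A'}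
    {β β' : B ⟶ B'} {w : α ≫ f' = f ≫ β} {w' : α' ≫ f' = f ≫ β'} (h : α = α') :
    Noy.homMk α β w = Noy.homMk α' β' w' :=
  Noy.homMk_eq_homMk_iff.2 ⟨0, by rw [h, sub_self, comp_zero]⟩

lemma Noy.homMk_eq_zero_iff {A B A' B' : a} {f : A ⟶ B} {f' : A' ⟶ B'} {α : A ⟶ A'}
    {β : B ⟶ B'} {w : α ≫ f' = f ≫ β} :
    Noy.homMk α β w = 0 ↔ ∃ h : B ⟶ A', α = f ≫ h := by
  have h : Noy.homMk (f := f) (f' := f') 0 0 (by simp) = 0 := (Noy.quotient a).map_zero _ _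
  rw [← h, Noy.homMk_eq_homMk_iff, sub_zero]

end NoyMorphisms

section NoyKernels

variable {a : Type u} [Category.{w} a] [Preadditive a] [HasZeroObject a]

instance : HasZeroObject (Noy a) :=
  ⟨⟨_, Functor.map_isZero (Noy.N a) (isZero_zero a)⟩⟩

instance [HasBinaryBiproducts a] : HasFiniteBiproducts (Noy a) := by
  have : HasFiniteProducts (Noy a) := hasFiniteProducts_of_has_binary_and_terminal
  exact HasFiniteBiproducts.of_hasFiniteProducts

open ZeroObject in
/-- The morphism from `f : A ⟶ B` to `A' ⟶ 0` given by a morphism `A ⟶ A'`. -/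
def Noy.toN {A B : a} (f : A ⟶ B) {A' : a} (α : A ⟶ A') : Noy.mk f ⟶ (Noy.N a).obj A' :=
  Noy.homMk (f' := (0 : A' ⟶ 0)) α 0 (by simp)

/-- The morphism from `f : A ⟶ B` to `A ⟶ 0` given by the identity of `A`. -/
def Noy.ι {A B : a} (f : A ⟶ B) : Noy.mk f ⟶ (Noy.N a).obj A := Noy.toN f (𝟙 A)

lemma Noy.homMk_comp_ι {A B A' B' : a} {f : A ⟶ B} {f' : A' ⟶ B'} (α : A ⟶ A') (β : B ⟶ B')
    (w : α ≫ f' = f ≫ β) : Noy.homMk α β w ≫ Noy.ι f' = Noy.toN f α :=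
  (Noy.homMk_comp _ _ _ _ _ _).trans (Noy.homMk_congr (Category.comp_id _))

lemma Noy.toN_comp_map {A B A' A'' : a} (f : A ⟶ B) (α : A ⟶ A') (β : A' ⟶ A'') :
    Noy.toN f α ≫ (Noy.N a).map β = Noy.toN f (α ≫ β) :=
  (Noy.homMk_comp _ _ _ _ _ _).trans (Noy.homMk_congr rfl)

lemma Noy.ι_comp_map {A B A' : a} (f : A ⟶ B) (α : A ⟶ A') :
    Noy.ι f ≫ (Noy.N a).map α = Noy.toN f α := by
  rw [Noy.ι, Noy.toN_comp_map, Category.id_comp]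

lemma Noy.ι_comp_map_self {A B : a} (f : A ⟶ B) : Noy.ι f ≫ (Noy.N a).map f = 0 := by
  rw [Noy.ι_comp_map]
  exact Noy.homMk_eq_zero_iff.2 ⟨𝟙 B, (Category.comp_id f).symm⟩

open ZeroObject in
lemma Noy.ι_zero (A : a) : Noy.ι (0 : A ⟶ 0) = 𝟙 ((Noy.N a).obj A) :=
  (Noy.homMk_congr rfl).trans ((Noy.quotient a).map_id (Arrow.mk (0 : A ⟶ 0)))

/-- Whether a class vanishes depends on its upper component and its source only, and `ι f` changes
neither. -/
instance {A B : a} (f : A ⟶ B) : Mono (Noy.ι f) := by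
  refine Preadditive.mono_of_cancel_zero _ fun {Y} g hg => ?_
  obtain ⟨A', B', f', rfl⟩ := Y.exists_eq_mk
  obtain ⟨α, β, w, rfl⟩ := Noy.exists_eq_homMk g
  rw [Noy.homMk_comp_ι] at hg
  exact Noy.homMk_eq_zero_iff.2 (Noy.homMk_eq_zero_iff.1 hg)

/-- Every object of `Noy a` is the kernel of a morphism in the image of `N`. -/
def Noy.isLimitKernel {A B : a} (f : A ⟶ B) :
    IsLimit (KernelFork.ofι (Noy.ι f) (Noy.ι_comp_map_self f)) := by
  refine KernelFork.IsLimit.ofι' _ _ fun {Y} g hg => Classical.choice ?_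
  obtain ⟨A', B', f', rfl⟩ := Y.exists_eq_mk
  obtain ⟨α, β, w, hα⟩ := Noy.exists_eq_homMk g
  have e : g = Noy.toN f' α := hα.trans (Noy.homMk_congr rfl)
  rw [e, Noy.toN_comp_map] at hg
  -- The factorization that witnesses vanishing is the missing lower edge of a square from `f'` to
  -- `f`.
  obtain ⟨h, w⟩ := Noy.homMk_eq_zero_iff.1 hg
  exact ⟨Noy.homMk α h w, (Noy.homMk_comp_ι _ _ _).trans e.symm⟩

variable {C : Type u₁} [Category.{v₁} C]

/-- A functor on `Noy a` is left exact if it preserves the kernels of the morphisms in the image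
of `N`. -/
def IsLeftExact (φ : Noy a ⥤ C) : Prop :=
  ∀ ⦃A B : a⦄ (f : A ⟶ B), PreservesLimit (parallelPair ((Noy.N a).map f) 0) φ

lemma IsLeftExact.comp {φ : Noy a ⥤ C} (hφ : IsLeftExact φ) {D : Type u₂} [Category.{v₂} D]
    (F : C ⥤ D) [PreservesFiniteLimits F] : IsLeftExact (φ ⋙ F) := fun A B f => by
  have := hφ f
  infer_instance

variable [Preadditive C] {φ ψ : Noy a ⥤ C}

/-- A left exact functor preserves the presentation of an object as a kernel. -/
def IsLeftExact.isLimit [φ.PreservesZeroMorphisms] (hφ : IsLeftExact φ) {A B : a} (f : A ⟶ B) :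
    IsLimit (KernelFork.ofι (φ.map (Noy.ι f)) (by
      rw [← φ.map_comp, Noy.ι_comp_map_self, φ.map_zero]) : KernelFork (φ.map ((Noy.N a).map f))) :=
  have := hφ f
  KernelFork.mapIsLimit _ (Noy.isLimitKernel f) φ

lemma IsLeftExact.mono_map_ι [φ.PreservesZeroMorphisms] (hφ : IsLeftExact φ) {A B : a}
    (f : A ⟶ B) : Mono (φ.map (Noy.ι f)) :=
  Fork.IsLimit.mono (hφ.isLimit f)

lemma IsLeftExact.exists_lift [φ.PreservesZeroMorphisms] (hφ : IsLeftExact φ) {A B : a}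
    (f : A ⟶ B) {P : C} (x : P ⟶ φ.obj ((Noy.N a).obj A)) (hx : x ≫ φ.map ((Noy.N a).map f) = 0) :
    ∃ r : P ⟶ φ.obj (Noy.mk f), r ≫ φ.map (Noy.ι f) = x :=
  ⟨_, (KernelFork.IsLimit.lift' (hφ.isLimit f) x hx).2⟩

lemma isLeftExact_of_lifts [φ.PreservesZeroMorphisms]
    (h : ∀ ⦃A B : a⦄ (f : A ⟶ B), Mono (φ.map (Noy.ι f)))
    (h' : ∀ ⦃A B : a⦄ (f : A ⟶ B) ⦃P : C⦄ (x : P ⟶ φ.obj ((Noy.N a).obj A)),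
      x ≫ φ.map ((Noy.N a).map f) = 0 → ∃ r : P ⟶ φ.obj (Noy.mk f), r ≫ φ.map (Noy.ι f) = x) :
    IsLeftExact φ := fun A B f => by
  refine preservesLimit_of_preserves_limit_cone (Noy.isLimitKernel f) ?_
  refine (KernelFork.isLimitMapConeEquiv _ φ).symm ?_
  have := h f
  exact KernelFork.IsLimit.ofι' (φ.map (Noy.ι f))
    (by rw [← φ.map_comp, Noy.ι_comp_map_self, φ.map_zero])
    fun x hx => Classical.choice ((h' f x hx).elim fun r hr => ⟨⟨r, hr⟩⟩)

lemma IsLeftExact.hom_ext [ψ.PreservesZeroMorphisms] (hψ : IsLeftExact ψ) {β γ : φ ⟶ ψ}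
    (h : ∀ A : a, β.app ((Noy.N a).obj A) = γ.app ((Noy.N a).obj A)) : β = γ := by
  ext X
  obtain ⟨A, B, f, rfl⟩ := X.exists_eq_mk
  have := hψ.mono_map_ι f
  rw [← cancel_mono (ψ.map (Noy.ι f)), ← β.naturality, ← γ.naturality, h]

variable [φ.PreservesZeroMorphisms] [ψ.PreservesZeroMorphisms]

-- The component at `f` is the map induced on kernels; naturality is checked after the monomorphism
-- `ψ (ι f')`.
open ZeroObject in
lemma IsLeftExact.exists_hom (hψ : IsLeftExact ψ) (β : Noy.N a ⋙ φ ⟶ Noy.N a ⋙ ψ) :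
    ∃ γ : φ ⟶ ψ, ∀ A : a, γ.app ((Noy.N a).obj A) = β.app A := by
  have hn : ∀ {A B : a} (f : A ⟶ B), φ.map ((Noy.N a).map f) ≫ β.app B =
      β.app A ≫ ψ.map ((Noy.N a).map f) := fun f => β.naturality f
  have H : ∃ r : ∀ X : Noy a, φ.obj X ⟶ ψ.obj X, ∀ {A B : a} (f : A ⟶ B),
      r (Noy.mk f) ≫ ψ.map (Noy.ι f) = φ.map (Noy.ι f) ≫ β.app A := by
    choose r hr using fun (A B : a) (f : A ⟶ B) =>
      hψ.exists_lift f (φ.map (Noy.ι f) ≫ β.app A) (by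
        rw [Category.assoc]
        refine (congrArg _ (hn f)).symm.trans ?_
        rw [← Category.assoc, ← φ.map_comp, Noy.ι_comp_map_self, φ.map_zero, zero_comp])
    exact ⟨fun X => r _ _ X.as.hom, fun f => hr _ _ f⟩
  obtain ⟨r, hr⟩ := H
  refine ⟨{ app := r, naturality := fun X Y g => ?_ }, fun A => ?_⟩
  · obtain ⟨A, B, f, rfl⟩ := X.exists_eq_mk
    obtain ⟨A', B', f', rfl⟩ := Y.exists_eq_mk
    obtain ⟨α, α', w, rfl⟩ := Noy.exists_eq_homMk g
    have := hψ.mono_map_ι f'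
    have e : Noy.homMk α α' w ≫ Noy.ι f' = Noy.ι f ≫ (Noy.N a).map α := by
      rw [Noy.homMk_comp_ι, Noy.ι_comp_map]
    rw [← cancel_mono (ψ.map (Noy.ι f')), Category.assoc, Category.assoc, hr, ← ψ.map_comp, e,
      ψ.map_comp, ← Category.assoc (r _), hr, Category.assoc]
    refine Eq.trans ?_ (congrArg (φ.map (Noy.ι f) ≫ ·) (hn α))
    exact ((Category.assoc _ _ _).symm.trans (congrArg (· ≫ β.app A')
      ((φ.map_comp _ _).symm.trans ((congrArg φ.map e).trans (φ.map_comp _ _))))).trans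
        (Category.assoc _ _ _)
  -- The inclusion `ι` of `A ⟶ 0` is an identity, so the component there is the prescribed one.
  · have e := hr (0 : A ⟶ 0)
    rw [Noy.ι_zero] at e
    exact ((Category.comp_id _).symm.trans (congrArg _ (ψ.map_id _).symm)).trans
      (e.trans ((congrArg (· ≫ β.app A) (φ.map_id _)).trans (Category.id_comp _)))

/-- Left exact functors on `Noy a` are determined by their restriction along `N`. -/
lemma IsLeftExact.nonempty_iso (hφ : IsLeftExact φ) (hψ : IsLeftExact ψ)
    (e : Noy.N a ⋙ φ ≅ Noy.N a ⋙ ψ) : Nonempty (φ ≅ ψ) := by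
  obtain ⟨β, hβ⟩ := hψ.exists_hom e.hom
  obtain ⟨γ, hγ⟩ := hφ.exists_hom e.inv
  refine ⟨⟨β, γ, hφ.hom_ext fun A => ?_, hψ.hom_ext fun A => ?_⟩⟩
  · exact (congrArg₂ (· ≫ ·) (hβ A) (hγ A)).trans (e.hom_inv_id_app A)
  · exact (congrArg₂ (· ≫ ·) (hγ A) (hβ A)).trans (e.inv_hom_id_app A)

end NoyKernels

section NoyKernelLifts

variable {a : Type u} [Category.{w} a] [Preadditive a] [HasZeroObject a] [HasBinaryBiproducts a]
  {C : Type u₁} [Category.{v₁} C] [Preadditive C]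

/-- An element of the kernel of `f'` that `α` kills is an element of `A'` killed by `(f', α) : A' ⟶
B' ⊞ A`; this arrow, as an object of `Noy a`, is the weak kernel. -/
lemma IsLeftExact.hasKernelLifts {φ : Noy a ⥤ C}
    [φ.Additive] (hφ : IsLeftExact φ) : HasKernelLifts φ := by
  intro X Y g
  obtain ⟨A, B, f, rfl⟩ := X.exists_eq_mk
  obtain ⟨A', B', f', rfl⟩ := Y.exists_eq_mk
  obtain ⟨α, β, w, rfl⟩ := Noy.exists_eq_homMk g
  have hg : Noy.homMk α β w ≫ Noy.ι f = Noy.ι f' ≫ (Noy.N a).map α := by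
    rw [Noy.homMk_comp_ι, Noy.ι_comp_map]
  refine ⟨Noy.mk (biprod.lift f' α), Noy.homMk (𝟙 A') biprod.fst (by simp), ?_, fun P x hx => ?_⟩
  · rw [Noy.homMk_comp]
    exact Noy.homMk_eq_zero_iff.2 ⟨biprod.snd, by simp⟩
  · have h : (x ≫ φ.map (Noy.ι f')) ≫ φ.map ((Noy.N a).map (biprod.lift f' α)) = 0 := by
      rw [Category.assoc, ← φ.map_comp, biprod.lift_eq, (Noy.N a).map_add,
        (Noy.N a).map_comp, (Noy.N a).map_comp, Preadditive.comp_add, ← Category.assoc,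
        ← Category.assoc,
        Noy.ι_comp_map_self, ← hg, zero_comp, zero_add, Category.assoc, φ.map_comp,
        ← Category.assoc, hx, zero_comp]
    obtain ⟨r, hr⟩ := hφ.exists_lift _ _ h
    have := hφ.mono_map_ι f'
    refine ⟨r, ?_⟩
    rw [← cancel_mono (φ.map (Noy.ι f')), Category.assoc, ← φ.map_comp, Noy.homMk_comp_ι]
    exact hr

end NoyKernelLifts

/-! ### The left exact extension `vec θ`. -/

section Vec

variable {a : Type u} [Category.{w} a] [Preadditive a]
  {C : Type u₁} [Category.{v₁} C] [Preadditive C] [HasKernels C] (θ : a ⥤ C) [θ.Additive]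

/-- The inclusion of the kernel of `θ f`. -/
def vecι {A B : a} (f : A ⟶ B) : (vec θ).obj (Noy.mk f) ⟶ θ.obj A := kernel.ι (θ.map f)

instance {A B : a} (f : A ⟶ B) : Mono (vecι θ f) :=
  inferInstanceAs (Mono (kernel.ι (θ.map f)))

lemma vec_exists_lift {A B : a} (f : A ⟶ B) {P : C} (x : P ⟶ θ.obj A) (hx : x ≫ θ.map f = 0) :
    ∃ r : P ⟶ (vec θ).obj (Noy.mk f), r ≫ vecι θ f = x :=
  ⟨kernel.lift (θ.map f) x hx, kernel.lift_ι (θ.map f) x hx⟩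

lemma vec_map_homMk_comp {A B A' B' : a} {f : A ⟶ B} {f' : A' ⟶ B'} (α : A ⟶ A') (β : B ⟶ B')
    (w : α ≫ f' = f ≫ β) :
    (vec θ).map (Noy.homMk α β w) ≫ vecι θ f' = vecι θ f ≫ θ.map α :=
  kernel.lift_ι (θ.map f') _ _

instance : (vec θ).Additive where
  map_add {X Y g g'} := by
    obtain ⟨A, B, f, rfl⟩ := X.exists_eq_mk
    obtain ⟨A', B', f', rfl⟩ := Y.exists_eq_mk
    obtain ⟨α, β, w, rfl⟩ := Noy.exists_eq_homMk g
    obtain ⟨α', β', w', rfl⟩ := Noy.exists_eq_homMk g'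
    have e : Noy.homMk α β w + Noy.homMk α' β' w' = Noy.homMk (α + α') (β + β')
        (by rw [Preadditive.add_comp, w, w', Preadditive.comp_add]) :=
      ((Noy.quotient a).map_add).symm
    rw [e, ← cancel_mono (vecι θ f'), vec_map_homMk_comp, θ.map_add, Preadditive.comp_add,
      ← vec_map_homMk_comp θ α β w, ← vec_map_homMk_comp θ α' β' w']
    exact (Preadditive.add_comp _ _ _ _ _ _).symm

variable [HasZeroObject a]

open ZeroObject in
instance isIso_vecι_zero (A : a) : IsIso (vecι θ (0 : A ⟶ 0)) := by
  obtain ⟨r, hr⟩ := vec_exists_lift θ (0 : A ⟶ 0) (𝟙 _) (by rw [θ.map_zero, comp_zero])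
  exact ⟨r, by rw [← cancel_mono (vecι θ (0 : A ⟶ 0)), Category.assoc, hr, Category.comp_id,
    Category.id_comp], hr⟩

open ZeroObject in
/-- The functor `θ⃗` extends `θ`. -/
def nCompVec : Noy.N a ⋙ vec θ ≅ θ :=
  NatIso.ofComponents (fun A => @asIso _ _ _ _ (vecι θ (0 : A ⟶ 0)) (isIso_vecι_zero θ A))
    (fun _ => vec_map_homMk_comp θ _ _ _)

open ZeroObject in
lemma vec_map_ι_comp {A B : a} (f : A ⟶ B) :
    (vec θ).map (Noy.ι f) ≫ (nCompVec θ).hom.app A = vecι θ f := by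
  refine (vec_map_homMk_comp θ (f' := (0 : A ⟶ 0)) (𝟙 A) 0 (by simp)).trans ?_
  rw [θ.map_id, Category.comp_id]

lemma isLeftExact_vec : IsLeftExact (vec θ) := by
  refine isLeftExact_of_lifts (fun A B f => ?_) (fun A B f P x hx => ?_)
  · have : Mono ((vec θ).map (Noy.ι f) ≫ (nCompVec θ).hom.app A) := by
      rw [vec_map_ι_comp]
      infer_instance
    exact mono_of_mono _ ((nCompVec θ).hom.app A)
  · obtain ⟨r, hr⟩ := vec_exists_lift θ f (x ≫ (nCompVec θ).hom.app A) (by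
      rw [Category.assoc, ← (nCompVec θ).hom.naturality, Functor.comp_map, ← Category.assoc, hx,
        zero_comp])
    refine ⟨r, (cancel_mono ((nCompVec θ).hom.app A)).1 ?_⟩
    rw [Category.assoc]
    exact (congrArg _ (vec_map_ι_comp θ f)).trans hr

end Vec

/-! ### Left exactness of `Z`, and natural transformations determined along `Z`. -/

section Zed

variable {b : Type u} [Category.{w} b] [Preadditive b] [HasBinaryBiproducts b]
  [EssentiallySmall.{w} b]

instance : PreservesFiniteLimits (yon : b ⥤ PSh b) where
  preservesFiniteLimits J _ _ := ⟨fun {K} => by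
    have : PreservesLimit K (yon ⋙ (additiveFunctor bᵒᵖ AddCommGrpCat.{w}).ι) :=
      preservesLimit_of_evaluation preadditiveYoneda K fun Y =>
        inferInstanceAs (PreservesLimit K (preadditiveCoyoneda.obj Y))
    exact preservesLimit_of_reflects_of_preserves yon (additiveFunctor bᵒᵖ AddCommGrpCat.{w}).ι⟩

instance (T : AdditiveTopology b) : PreservesFiniteLimits (zed T) :=
  comp_preservesFiniteLimits _ _

end Zed

section Density

variable {b : Type u} [Category.{w} b] [Preadditive b] [HasBinaryBiproducts b]
  [EssentiallySmall.{w} b] {T : AdditiveTopology b} {C : Type u₁} [Category.{v₁} C]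
  {F F' : Sh T ⥤ C} [PreservesColimitsOfSize.{w, w} F]

lemma hom_ext_of_map_section {S : Sh T} {A : C} {x y : F.obj S ⟶ A}
    (h : ∀ ⦃X : b⦄ (s : (zed T).obj X ⟶ S), F.map s ≫ x = F.map s ≫ y) : x = y := by
  obtain ⟨m, -, hm⟩ := existsUnique_desc_sections F S (fun e => F.map (sectionHom e) ≫ y)
    (fun r => by rw [← Category.assoc, ← F.map_comp, map_relationHom_sectionHom])
  exact (hm x fun e => h _).trans (hm y fun e => rfl).symm

lemma natTrans_ext_of_zed {α β : F ⟶ F'}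
    (h : ∀ X : b, α.app ((zed T).obj X) = β.app ((zed T).obj X)) : α = β := by
  ext S
  exact hom_ext_of_map_section fun X s => by rw [α.naturality, β.naturality, h]

/-- As `F` is cocontinuous, `F S` is the colimit of the `F (Z X)` over the sections of `S`, so `β`
induces the component at `S`. -/
lemma exists_natTrans_of_zed (β : zed T ⋙ F ⟶ zed T ⋙ F') :
    ∃ γ : F ⟶ F', ∀ X : b, γ.app ((zed T).obj X) = β.app X := by
  have hβ : ∀ {X Y : b} (f : X ⟶ Y), F.map ((zed T).map f) ≫ β.app Y =
      β.app X ≫ F'.map ((zed T).map f) := fun f => β.naturality f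
  have H : ∀ S : Sh T, ∃ m : F.obj S ⟶ F'.obj S, ∀ ⦃X : b⦄ (s : (zed T).obj X ⟶ S),
      F.map s ≫ m = β.app X ≫ F'.map s := fun S => by
    obtain ⟨m, hm, -⟩ := existsUnique_desc_sections F S
      (fun e => β.app (sectionObj e) ≫ F'.map (sectionHom e)) (fun r => by
        rw [← map_relationHom_sectionHom r, F'.map_comp, ← Category.assoc, ← Category.assoc]
        exact congrArg (· ≫ F'.map (sectionHom r.2.1)) (hβ (relationHom r)))
    refine ⟨m, fun X s => ?_⟩
    obtain ⟨e, -, i, -, -, hi⟩ := exists_sectionHom s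
    rw [← hi, F.map_comp, F'.map_comp, Category.assoc, hm, ← Category.assoc, ← Category.assoc]
    exact congrArg (· ≫ F'.map (sectionHom e)) (hβ i)
  choose m hm using H
  refine ⟨{ app := m, naturality := fun S S' g => hom_ext_of_map_section fun X s => ?_ },
    fun X => ?_⟩
  · rw [← Category.assoc, ← F.map_comp, hm, ← Category.assoc, hm, Category.assoc, F'.map_comp]
  · have := hm _ (𝟙 ((zed T).obj X))
    rw [F.map_id, F'.map_id] at this
    exact (Category.id_comp _).symm.trans (this.trans (Category.comp_id _))

end Density

/-! ### Invariance of homological topologies. -/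

section Composition

/-- `G` commutes with the coproducts, preserves epimorphisms by right exactness and reflects them by
faithfulness. -/
lemma coveringSystem_comp {b : Type u} [Category.{v} b] [Preadditive b]
    {C : Type u₁} [Category.{v₁} C] [Preadditive C] [HasCoproducts.{w} C]
    {B : Type u₂} [Category.{v₂} B] [Preadditive B] [HasCoproducts.{w} B]
    (φ : b ⥤ C) (G : C ⥤ B) [G.Faithful] [PreservesFiniteColimits G]
    [PreservesColimitsOfSize.{w, w} G] :
    coveringSystem (φ ⋙ G) = coveringSystem φ := by
  ext X R
  refine exists_congr fun I => exists_congr fun Y => exists_congr fun f =>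
    and_congr_right fun _ => ?_
  have e : Sigma.desc (fun i => (φ ⋙ G).map (f i)) =
      sigmaComparison G (fun i => φ.obj (Y i)) ≫ G.map (Sigma.desc fun i => φ.map (f i)) :=
    (sigmaComparison_map_desc G (fun i => φ.obj (Y i)) _ fun i => φ.map (f i)).symm
  rw [← G.epi_map_iff_epi]
  refine Iff.trans (iff_of_eq (congrArg Epi e)) ?_
  exact ⟨fun _ => epi_of_epi (sigmaComparison G (fun i => φ.obj (Y i))) _, fun _ => epi_comp _ _⟩

variable {a : Type u} [Category.{w} a] [Preadditive a] [HasZeroObject a]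
  [EssentiallySmall.{w} a]
  {C : Type u₁} [Category.{v₁} C] [Preadditive C] [HasKernels C] [HasCoproducts.{w} C]

/-- By uniqueness of left exact extensions, any of them computes the topology; this replaces `vec`
by `zed R` or by `vec θ ⋙ G` below. -/
lemma homologicalTopology_eq_coveringSystem (θ : a ⥤+ C) {φ : Noy a ⥤ C}
    [φ.PreservesZeroMorphisms] (hφ : IsLeftExact φ) (e : Noy.N a ⋙ φ ≅ θ.obj) :
    homologicalTopology θ = coveringSystem φ := by
  obtain ⟨i⟩ := (isLeftExact_vec θ.obj).nonempty_iso hφ (nCompVec θ.obj ≪≫ e.symm)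
  exact coveringSystem_congr i

lemma homologicalTopology_congr {θ θ' : a ⥤+ C} (e : θ ≅ θ') :
    homologicalTopology θ = homologicalTopology θ' :=
  homologicalTopology_eq_coveringSystem θ (isLeftExact_vec θ'.obj)
    (nCompVec θ'.obj ≪≫ (additiveFunctor a C).ι.mapIso e.symm)

lemma hasHTop_unique {θ θ' : a ⥤+ C} (e : θ ≅ θ') {R R' : HTop a} (h : hasHTop C R θ)
    (h' : hasHTop C R' θ') : R = R' :=
  AdditiveTopology.ext (h.symm.trans ((homologicalTopology_congr e).trans h'))

lemma homologicalTopology_comp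
    {B : Type u₂} [Category.{v₂} B] [Preadditive B] [HasKernels B] [HasCoproducts.{w} B]
    (θ : a ⥤+ C) (G : AB5Hom.{w} C B) :
    homologicalTopology (((postcomp C B a).obj θ).obj G) = homologicalTopology θ := by
  obtain ⟨_, _, _, _, _⟩ := G.property
  refine (homologicalTopology_eq_coveringSystem _ ((isLeftExact_vec θ.obj).comp G.obj)
    ((Functor.associator _ _ _).symm ≪≫
      Functor.isoWhiskerRight (nCompVec θ.obj) G.obj)).trans ?_
  exact coveringSystem_comp _ _

end Composition

/-! ### Decomposition over the homological topologies. -/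

section Decomposition

variable {a : Type u} [Category.{w} a] [Preadditive a] [HasZeroObject a] [HasBinaryBiproducts a]
  [EssentiallySmall.{w} a] {C : Type u₁} [Category.{v₁} C] [Abelian C]
  [HasColimitsOfSize.{w, w} C] [AB5OfSize.{w, w} C]

lemma exists_hasHTop (θ : a ⥤+ C) : ∃ R : HTop a, hasHTop C R θ :=
  ⟨coveringTopology (vec θ.obj) (isLeftExact_vec θ.obj).hasKernelLifts, rfl⟩

lemma decomposition_obj_bijective : Function.Bijective (decomposition a C).obj := by
  constructor
  · rintro ⟨R, θ, h⟩ ⟨R', θ', h'⟩ (rfl : θ = θ')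
    obtain rfl := hasHTop_unique (Iso.refl _) h h'
    rfl
  · intro θ
    obtain ⟨R, h⟩ := exists_hasHTop θ
    exact ⟨⟨R, θ, h⟩, rfl⟩

instance decomposition_faithful : (decomposition a C).Faithful where
  map_injective {X Y} f g h := by
    obtain ⟨f⟩ := f
    obtain ⟨g⟩ := g
    exact congrArg _ ((hasHTop C _).ι.map_injective h)

/-- Isomorphic functors have the same topology, so no isomorphism joins different summands; this is
the only obstacle to fullness. -/
instance : (decomposition a C).core.IsEquivalence where
  faithful := ⟨fun {X Y} f g h => by
    ext
    exact (decomposition a C).map_injective (congrArg (fun i => i.iso.hom) h)⟩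
  full := ⟨fun {X Y} f => by
    obtain ⟨R, θ, h⟩ := X
    obtain ⟨R', θ', h'⟩ := Y
    obtain rfl := hasHTop_unique f.iso h h'
    exact ⟨⟨(Sigma.incl R).mapIso ((hasHTop C R).isoMk f.iso)⟩, by ext; rfl⟩⟩
  essSurj := ⟨fun θ => by
    obtain ⟨X, hX⟩ := decomposition_obj_bijective.2 θ.of
    exact ⟨⟨X⟩, ⟨Core.isoMk (eqToIso hX)⟩⟩⟩

end Decomposition

/-! ### Representability by `HSh R`. -/

section Representability

variable {a : Type u} [Category.{w} a] [Preadditive a] [HasZeroObject a] [HasBinaryBiproducts a]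
  [EssentiallySmall.{w} a] (R : HTop a)

lemma isLeftExact_zed : IsLeftExact (zed R) := fun _ _ _ => inferInstance

section

variable {C : Type u₁} [Category.{v₁} C] [Preadditive C]

lemma isLeftExact_zed_comp (F : AB5Hom.{w} (HSh R) C) : IsLeftExact (zed R ⋙ F.obj) :=
  have := F.property.2.2.1
  (isLeftExact_zed R).comp F.obj

lemma hasHTop_precomp [HasKernels C] [HasCoproducts.{w} C] (F : AB5Hom.{w} (HSh R) C) :
    hasHTop C R ((precomp C (HZ R)).obj F) := by
  obtain ⟨_, _, _, _, _⟩ := F.property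
  exact (homologicalTopology_eq_coveringSystem _ (isLeftExact_zed_comp R F) (Iso.refl _)).trans
    ((coveringSystem_comp _ _).trans (coveringSystem_zed R))

/-- Density reduces equality to the objects `Z X`, and left exactness of `zed R ⋙ F'` reduces it
further to the image of `N`. Fullness extends transformations in the opposite order. -/
lemma precomp_faithful : (precomp.{w} C (HZ R)).Faithful where
  map_injective {F F'} α β h := by
    have := F.property.2.2.2.2
    have := F'.property.1
    ext1
    refine natTrans_ext_of_zed (T := R) fun X => ?_
    refine congrArg (fun γ : zed R ⋙ F.obj ⟶ zed R ⋙ F'.obj => γ.app X)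
      ((isLeftExact_zed_comp R F').hom_ext (β := Functor.whiskerLeft (zed R) α.hom)
        (γ := Functor.whiskerLeft (zed R) β.hom) fun A => ?_)
    exact congrArg (fun γ => γ.hom.app A) h

lemma precomp_full : (precomp.{w} C (HZ R)).Full where
  map_surjective {F F'} α := by
    have := F.property.2.2.2.2
    have := F.property.1
    have := F'.property.1
    obtain ⟨β, hβ⟩ := (isLeftExact_zed_comp R F').exists_hom (φ := zed R ⋙ F.obj) α.hom
    obtain ⟨γ, hγ⟩ := exists_natTrans_of_zed β
    refine ⟨ObjectProperty.homMk γ, ?_⟩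
    ext1
    ext A
    exact (hγ _).trans (hβ A)

end

variable {C : Type u₁} [Category.{v₁} C] [Abelian C] [LocallySmall.{w} C]
  [HasColimitsOfSize.{w, w} C] [AB5OfSize.{w, w} C]

/-- The realization of `vec θ` restricts to `vec θ` along `Z`, hence to `θ` along `HZ`. -/
lemma exists_precomp_iso {θ : a ⥤+ C} (h : hasHTop C R θ) :
    ∃ F : AB5Hom.{w} (HSh R) C, Nonempty ((precomp C (HZ R)).obj F ≅ θ) := by
  have hφ := (isLeftExact_vec θ.obj).hasKernelLifts
  have hT : ∀ ⦃X : Noy a⦄ ⦃S : AdditiveSieve X⦄, S ∈ R.sieves X → JointlyEpi (vec θ.obj) S :=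
    fun X S hS => (mem_coveringSystem_iff _ _).1 (by
      rw [← show homologicalTopology θ = R.sieves from h] at hS
      exact hS)
  refine ⟨⟨realization (vec θ.obj) hφ hT, isAB5Functor_realization _ hφ hT h⟩,
    ⟨ObjectProperty.isoMk _ ?_⟩⟩
  exact Functor.isoWhiskerLeft (Noy.N a) (zedCompRealization (vec θ.obj) hφ hT) ≪≫
    nCompVec θ.obj

lemma isEquivalence_precomp :
    ((hasHTop C R).lift (precomp C (HZ R)) (hasHTop_precomp R)).IsEquivalence where
  faithful :=
    have := precomp_faithful.{w} R (C := C)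
    inferInstance
  full :=
    have := precomp_full.{w} R (C := C)
    inferInstance
  essSurj := ⟨fun θ => by
    obtain ⟨F, ⟨e⟩⟩ := exists_precomp_iso R θ.property
    exact ⟨F, ⟨ObjectProperty.isoMk _ e⟩⟩⟩

end Representability

/-! ### Tightness of `HZ`. -/

section Tightness

variable {a : Type u} [Category.{w} a] [Preadditive a] [HasZeroObject a] [HasBinaryBiproducts a]
  [EssentiallySmall.{w} a] (R : HTop a)

lemma ab3Tight_HZ : AB3Tight.{w} (HZ R).obj := by
  intro P hP hZ
  have := hP.kernels
  have := hP.cokernels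
  have := hP.coproducts
  have h₁ : ∀ X : Noy a, P ((zed R).obj X) := fun X => by
    obtain ⟨A, B, f, rfl⟩ := X.exists_eq_mk
    exact P.prop_of_isLimit_kernelFork ((isLeftExact_zed R).isLimit f) (hZ A) (hZ B)
  ext S
  refine iff_of_true ?_ trivial
  -- For the identity functor, `isColimitGenerators` presents `S` itself as a cokernel between
  -- coproducts of objects `Z X`.
  exact P.prop_of_isColimit_cokernelCofork (isColimitGenerators (𝟭 (Sh R)) S)
    (P.prop_colimit _ fun j => h₁ _) (P.prop_colimit _ fun j => h₁ _)

end Tightness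

end

end HomTop

open CategoryTheory CategoryTheory.Limits HomTop
theorem mainTheorem2
    {a : Type u} [Category.{w} a] [Preadditive a] [HasZeroObject a] [HasBinaryBiproducts a]
    [EssentiallySmall.{w} a] :
    -- (1) the decomposition over the homological topologies
    (∀ (C : Type u₁) [Category.{v₁} C] [Abelian C] [LocallySmall.{w} C]
        [HasColimitsOfSize.{w, w} C] [AB5OfSize.{w, w} C],
      Function.Bijective (decomposition a C).obj ∧
      (∀ R : HTop a, (Sigma.incl R ⋙ decomposition a C).Full ∧
        (Sigma.incl R ⋙ decomposition a C).Faithful) ∧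
      (decomposition a C).core.IsEquivalence) ∧
    (∀ (C : Type u₁) [Category.{v₁} C] [Abelian C] [LocallySmall.{w} C]
        [HasColimitsOfSize.{w, w} C] [AB5OfSize.{w, w} C]
        (B : Type u₂) [Category.{v₂} B] [Abelian B] [LocallySmall.{w} B]
        [HasColimitsOfSize.{w, w} B] [AB5OfSize.{w, w} B]
        (θ : a ⥤+ C) (G : AB5Hom.{w} C B),
      homologicalTopology (((postcomp C B a).obj θ).obj G) = homologicalTopology θ) ∧
    ∀ R : HTop a,
      -- (2) representability
      IsAB5Category.{w} (HSh R) ∧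
      (∀ (C : Type u₁) [Category.{v₁} C] [Abelian C] [LocallySmall.{w} C]
          [HasColimitsOfSize.{w, w} C] [AB5OfSize.{w, w} C],
        ∃ h : ∀ F : AB5Hom.{w} (HSh R) C, hasHTop C R ((precomp C (HZ R)).obj F),
          ((hasHTop C R).lift (precomp C (HZ R)) h).IsEquivalence) ∧
      (∀ (C : Type u₁) [Category.{v₁} C] [Abelian C] [LocallySmall.{w} C]
          [HasColimitsOfSize.{w, w} C] [AB5OfSize.{w, w} C]
          (B : Type u₂) [Category.{v₂} B] [Abelian B] [LocallySmall.{w} B]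
          [HasColimitsOfSize.{w, w} B] [AB5OfSize.{w, w} B],
        precomp C (HZ R) ⋙ postcomp.{w} C B a =
          AB5Hom.comp (HSh R) C B ⋙ (Functor.whiskeringRight _ _ _).obj (precomp B (HZ R))) ∧
      -- (3) tightness
      AB3Tight.{w} (HZ R).obj :=
  ⟨fun C => ⟨decomposition_obj_bijective, fun R =>
      ⟨inferInstanceAs (hasHTop C R).ι.Full, inferInstanceAs (hasHTop C R).ι.Faithful⟩,
      inferInstance⟩,
    fun _ _ _ _ _ _ _ _ _ _ _ _ θ G => homologicalTopology_comp θ G,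
    fun R => ⟨isAB5Category_sh R, fun _ => ⟨hasHTop_precomp R, isEquivalence_precomp R⟩,
      fun _ _ _ _ _ _ _ _ _ _ _ _ => rfl, ab3Tight_HZ R⟩⟩
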